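/- Fix a real number $1\le p<\infty$, and write $\mathbb C_\theta=\{s\in\mathbb C:\operatorname{Re}s>\theta\}$. Let $\mathscr H^p$ be the completion of the space of Dirichlet polynomials $P(s)=\sum_{n=1}^N b_n n^{-s}$ with respect to the norm $\|P\|_{\mathscr H^p}=\big(\lim_{T\to\infty}\frac1T\int_0^T|P(it)|^p\,dt\big)^{1/p}$; its elements are regarded as functions on $\mathbb C_{1/2}$, and $\|\delta_s\|$ is the norm of the point evaluation $\delta_s:f\mapsto f(s)$ on $\mathscr H^p$ ($s\in\mathbb C_{1/2}$). Let $\mathscr H^\infty$ be the space of bounded analytic functions on $\mathbb C_0$ that are represented by a Dirichlet series in some half-plane, with the supremum norm $\|\cdot\|_\infty$ on $\mathbb C_0$. For a bounded operator $T$ on a Banach space and $n\ge1$ let $a_n(T)=\inf\{\|T-R\|:\operatorname{rank}R<n\}$. For an $n$-point set $S=\{s_1,\dots,s_n\}\subset\mathbb C_{1/2}$ define the following. - $M_{\mathscr H^\infty}(S)$ is the best constant $K$ such that for all $a_1,\dots,a_n\in\mathbb C$ there is $f\in\mathscr H^\infty$ with $f(s_j)=a_j$ for all $j$ and $\|f\|_\infty\le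 K\max_j|a_j|$. - $\mu_S=\sum_{j=1}^n\|\delta_{s_j}\|^{-p}\,\delta_{s_j}$, where here the second $\delta_{s_j}$ denotes the unit point mass at $s_j$. - For a nonnegative Borel measure $\mu$ on $\mathbb C_{1/2}$, $\|\mu\|_{\mathcal C,\mathscr H^p}$ is the smallest $C$ such that $\int_{\mathbb C_{1/2}}|f|^p\,d\mu\le C\|f\|_{\mathscr H^p}^p$ for all $f\in\mathscr H^p$ (and $\infty$ if there is no such $C$). **Theorem.** There is a constant $\rho_p>0$, depending only on $p$, such that the following holds. Let $\varphi:\mathbb C_{1/2}\to\mathbb C_{1/2}$ be an analytic map of the form $\varphi(s)=c_0s+\sum_{n=1}^\infty c_nn^{-s}$, with $c_0$ a nonnegative integer (the Dirichlet series converging in some half-plane), such that the composition operator $C_\varphi f=f\circ\varphi$ is a compact operator on $\mathscr H^p$. Let $n\ge1$ and let $S=\{s_1,\dots,s_n\}$ and $S'=\{s'_1,\dots,s'_n\}$ be subsets of $\mathbb C_{1/2}$, both of cardinality $n$, with $\varphi(s'_j)=s_j$ for every $j$. Then $$a_n(C_\varphi)\ \ge\ \rho_p\, n^{-(1/\min(2,p)-1/p)}\,[M_{\mathscr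 H^\infty}(S)]^{-1}\,\|\mu_{S'}\|_{\mathcal C,\mathscr H^p}^{-1/p}\,\inf_{1\le j\le n}\left(\frac{\zeta(2\operatorname{Re}s_j)}{\zeta(2\operatorname{Re}s'_j)}\right)^{1/p}.$$ -/

import Mathlib

open MeasureTheory Filter Topology Set
open scoped ENNReal

namespace DirichletHardy

noncomputable section

/-- The Dirichlet polynomial `∑ b_n n^{-s}` with coefficients `b = P`, evaluated at `s`. -/
def dirichletEval (P : ℕ+ →₀ ℂ) (s : ℂ) : ℂ :=
  P.sum fun n b => b * (n : ℂ) ^ (-s)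

/-- `T⁻¹ ∫_0^T |P(it)|^p dt`. -/
def meanPow (p : ℝ) (P : ℕ+ →₀ ℂ) (T : ℝ) : ℝ :=
  T⁻¹ * ∫ t in (0 : ℝ)..T, ‖dirichletEval P (t * Complex.I)‖ ^ p

namespace MeanAux

/-- The algebra of trigonometric polynomials on `ℝ`; only used to prove that means exist. -/
def trigAlg : Subalgebra ℂ (ℝ → ℂ) :=
  Algebra.adjoin ℂ (range fun (l : ℝ) (t : ℝ) => Complex.exp (l * Complex.I * t))

theorem trig_mean (l : ℝ) : ∃ m : ℂ, Tendsto
    (fun T : ℝ => (T : ℂ)⁻¹ * ∫ t in (0 : ℝ)..T, Complex.exp (l * Complex.I * t)) atTop (𝓝 m) := by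
  by_cases hl : l = 0
  · refine ⟨1, tendsto_const_nhds.congr' ?_⟩
    filter_upwards [eventually_gt_atTop (0 : ℝ)] with T hT
    have : (T : ℂ) ≠ 0 := by exact_mod_cast hT.ne'
    simp [hl, this]
  · refine ⟨0, ?_⟩
    have hl' : (l : ℂ) * Complex.I ≠ 0 := by simp [hl]
    have hi : Tendsto (fun T : ℝ => (2 / |l|) * T⁻¹) atTop (𝓝 0) := by
      simpa using tendsto_inv_atTop_zero.const_mul (2 / |l|)
    refine squeeze_zero_norm' ?_ hi
    filter_upwards [eventually_gt_atTop (0 : ℝ)] with T hT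
    rw [integral_exp_mul_complex hl', norm_mul, norm_div]
    have h1 : ‖(l : ℂ) * Complex.I‖ = |l| := by simp
    have h2 : ‖Complex.exp (l * Complex.I * T) - Complex.exp (l * Complex.I * (0 : ℝ))‖ ≤ 2 := by
      refine (norm_sub_le _ _).trans ?_
      have e1 : Complex.exp (l * Complex.I * T) = Complex.exp ((l * T : ℝ) * Complex.I) := by
        congr 1; push_cast; ring
      rw [e1, Complex.norm_exp_ofReal_mul_I]
      simp; norm_num
    rw [h1, norm_inv, Complex.norm_real, Real.norm_of_nonneg hT.le, mul_comm]
    gcongr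

theorem trigAlg_mean {g : ℝ → ℂ} (hg : g ∈ trigAlg) : Continuous g ∧ ∃ m : ℂ, Tendsto
    (fun T : ℝ => (T : ℂ)⁻¹ * ∫ t in (0 : ℝ)..T, g t) atTop (𝓝 m) := by
  set E : Set (ℝ → ℂ) := range fun (l : ℝ) (t : ℝ) => Complex.exp (l * Complex.I * t) with hE
  have hsub : (Submonoid.closure E : Set (ℝ → ℂ)) ⊆ Submodule.span ℂ E := by
    let M : Submonoid (ℝ → ℂ) :=
      { carrier := E
        one_mem' := ⟨0, by ext; simp⟩
        mul_mem' := by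
          rintro _ _ ⟨l, rfl⟩ ⟨k, rfl⟩
          refine ⟨l + k, ?_⟩
          ext t
          simp only [Pi.mul_apply, ← Complex.exp_add]
          congr 1; push_cast; ring }
    have : Submonoid.closure E ≤ M := Submonoid.closure_le.2 (fun x hx => hx)
    exact fun x hx => Submodule.subset_span (this hx)
  have hg' : g ∈ Submodule.span ℂ E := by
    rw [← Algebra.adjoin_eq_span_of_subset ℂ hsub]
    exact hg
  clear hg
  induction hg' using Submodule.span_induction with
  | mem x hx =>
    obtain ⟨l, rfl⟩ := hx
    exact ⟨by fun_prop, trig_mean l⟩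
  | zero => exact ⟨continuous_zero, 0, by simp⟩
  | add x y _ _ hx hy =>
    obtain ⟨cx, m, hm⟩ := hx
    obtain ⟨cy, k, hk⟩ := hy
    refine ⟨cx.add cy, m + k, (hm.add hk).congr fun T => ?_⟩
    simp only [Pi.add_apply]
    rw [intervalIntegral.integral_add (cx.intervalIntegrable _ _) (cy.intervalIntegrable _ _),
      mul_add]
  | smul a x _ hx =>
    obtain ⟨cx, m, hm⟩ := hx
    refine ⟨cx.const_smul a, a * m, (hm.const_mul a).congr fun T => ?_⟩
    simp only [Pi.smul_apply, smul_eq_mul, intervalIntegral.integral_const_mul]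
    ring

theorem dirichlet_mem (P : ℕ+ →₀ ℂ) :
    (fun t : ℝ => dirichletEval P (t * Complex.I)) ∈ trigAlg ∧
      (fun t : ℝ => star (dirichletEval P (t * Complex.I))) ∈ trigAlg := by
  have key : ∀ (n : ℕ+) (t : ℝ), (n : ℂ) ^ (-((t : ℂ) * Complex.I)) =
      Complex.exp ((-Real.log n : ℝ) * Complex.I * t) := by
    intro n t
    have hn : ((n : ℕ) : ℂ) ≠ 0 := by exact_mod_cast n.ne_zero
    rw [Complex.cpow_def_of_ne_zero hn, ← Complex.natCast_log]
    congr 1; push_cast; ring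
  have mem : ∀ l : ℝ, (fun t : ℝ => Complex.exp (l * Complex.I * t)) ∈ trigAlg := fun l =>
    Algebra.subset_adjoin ⟨l, rfl⟩
  constructor
  · have : (fun t : ℝ => dirichletEval P (t * Complex.I)) = ∑ n ∈ P.support, P n •
        fun t : ℝ => Complex.exp ((-Real.log n : ℝ) * Complex.I * t) := by
      ext t
      simp only [dirichletEval, Finsupp.sum, key, Finset.sum_apply, Pi.smul_apply, smul_eq_mul]
    rw [this]
    exact Subalgebra.sum_mem _ fun n _ => Subalgebra.smul_mem _ (mem _) _
  · have : (fun t : ℝ => star (dirichletEval P (t * Complex.I))) = ∑ n ∈ P.support, star (P n) •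
        fun t : ℝ => Complex.exp ((Real.log n : ℝ) * Complex.I * t) := by
      ext t
      simp only [dirichletEval, Finsupp.sum, key, Finset.sum_apply, Pi.smul_apply, smul_eq_mul,
        star_sum, star_mul', Complex.star_def, ← Complex.exp_conj]
      refine Finset.sum_congr rfl fun n _ => ?_
      congr 2
      simp only [map_mul, Complex.conj_ofReal, Complex.conj_I]
      push_cast; ring
    rw [this]
    exact Subalgebra.sum_mem _ fun n _ => Subalgebra.smul_mem _ (mem _) _

theorem continuous_eval (P : ℕ+ →₀ ℂ) :
    Continuous fun t : ℝ => dirichletEval P (t * Complex.I) :=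
  (trigAlg_mean (dirichlet_mem P).1).1

theorem norm_eval_le (P : ℕ+ →₀ ℂ) (t : ℝ) :
    ‖dirichletEval P (t * Complex.I)‖ ≤ ∑ n ∈ P.support, ‖P n‖ := by
  unfold dirichletEval Finsupp.sum
  refine (norm_sum_le _ _).trans (Finset.sum_le_sum fun n _ => ?_)
  have hn : ((n : ℕ) : ℂ) = ((n : ℕ) : ℝ) := by simp
  rw [norm_mul, hn, Complex.norm_cpow_eq_rpow_re_of_pos (by exact_mod_cast n.pos)]
  simp

theorem aeval_mem_trigAlg {g : ℝ → ℂ} (hg : g ∈ trigAlg) (R : Polynomial ℂ) :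
    Polynomial.aeval g R ∈ trigAlg :=
  Algebra.adjoin_le (Set.singleton_subset_iff.2 hg)
    (Polynomial.aeval_mem_adjoin_singleton ℂ g)

theorem poly_mean (P : ℕ+ →₀ ℂ) (Q : Polynomial ℝ) : ∃ m : ℝ, Tendsto
    (fun T : ℝ => T⁻¹ * ∫ t in (0 : ℝ)..T, Q.eval (‖dirichletEval P (t * Complex.I)‖ ^ 2))
      atTop (𝓝 m) := by
  have h := dirichlet_mem P
  have hsq := Subalgebra.mul_mem _ h.1 h.2
  have hQ : (fun t : ℝ => ((Q.eval (‖dirichletEval P (t * Complex.I)‖ ^ 2) : ℝ) : ℂ)) ∈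
      trigAlg := by
    have e : (fun t : ℝ => ((Q.eval (‖dirichletEval P (t * Complex.I)‖ ^ 2) : ℝ) : ℂ)) =
        Polynomial.aeval ((fun t : ℝ => dirichletEval P (t * Complex.I)) *
          (fun t : ℝ => star (dirichletEval P (t * Complex.I))))
          (Q.map (algebraMap ℝ ℂ)) := by
      ext t
      rw [Polynomial.aeval_def, Polynomial.eval₂_eq_sum_range, Polynomial.eval_eq_sum_range,
        Polynomial.natDegree_map, Finset.sum_apply]
      push_cast
      refine Finset.sum_congr rfl fun i _ => ?_
      simp [Complex.mul_conj', Pi.algebraMap_apply]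
    rw [e]
    exact aeval_mem_trigAlg hsq _
  obtain ⟨m, hm⟩ := (trigAlg_mean hQ).2
  refine ⟨m.re, ((Complex.continuous_re.tendsto m).comp hm).congr fun T => ?_⟩
  simp only [Function.comp, intervalIntegral.integral_ofReal, ← Complex.ofReal_inv,
    ← Complex.ofReal_mul, Complex.ofReal_re]

end MeanAux

open MeanAux in
theorem exists_tendsto_meanPow {p : ℝ} (hp : 1 ≤ p) (P : ℕ+ →₀ ℂ) :
    ∃ m : ℝ, Tendsto (meanPow p P) atTop (𝓝 m) := by
  set F : ℝ → ℂ := fun t => dirichletEval P (t * Complex.I) with hF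
  have hFc : Continuous F := continuous_eval P
  set M := ∑ n ∈ P.support, ‖P n‖
  have hcp : Continuous fun t => ‖F t‖ ^ p :=
    hFc.norm.rpow_const fun t => Or.inr (by linarith)
  refine cauchySeq_tendsto_of_complete (Metric.cauchySeq_iff'.2 fun ε hε => ?_)
  obtain ⟨Q, hQ⟩ := exists_polynomial_near_of_continuousOn 0 (M ^ 2) (fun x => x ^ (p / 2))
    (continuousOn_id.rpow_const fun x _ => Or.inr (by linarith)) (ε / 4) (by linarith)
  obtain ⟨m, hm⟩ := poly_mean P Q
  have hQc : Continuous fun t => Q.eval (‖F t‖ ^ 2) := by fun_prop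
  have close : ∀ T : ℝ, 0 < T →
      |meanPow p P T - T⁻¹ * ∫ t in (0 : ℝ)..T, Q.eval (‖F t‖ ^ 2)| ≤ ε / 4 := by
    intro T hT
    unfold meanPow
    rw [← mul_sub, ← intervalIntegral.integral_sub (hcp.intervalIntegrable _ _)
      (hQc.intervalIntegrable _ _), abs_mul, abs_of_pos (inv_pos.2 hT)]
    have : |∫ t in (0 : ℝ)..T, (‖F t‖ ^ p - Q.eval (‖F t‖ ^ 2))| ≤ ε / 4 * |T - 0| := by
      rw [← Real.norm_eq_abs]
      refine intervalIntegral.norm_integral_le_of_norm_le_const fun t _ => ?_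
      have h := hQ (‖F t‖ ^ 2) ⟨by positivity, by
        have := norm_eval_le P t
        gcongr⟩
      have e : (‖F t‖ ^ 2) ^ (p / 2) = ‖F t‖ ^ p := by
        rw [← Real.rpow_natCast, ← Real.rpow_mul (norm_nonneg _)]
        congr 1; push_cast; ring
      simp only [e] at h
      rw [Real.norm_eq_abs, abs_sub_comm]
      exact h.le
    rw [sub_zero, abs_of_pos hT] at this
    calc T⁻¹ * _ ≤ T⁻¹ * (ε / 4 * T) := by gcongr
      _ = ε / 4 := by field_simp
  obtain ⟨N, hN⟩ := Metric.tendsto_atTop.1 hm (ε / 8) (by linarith)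
  refine ⟨max N 1, fun T hT => ?_⟩
  have a1 := close T (by linarith [le_max_right N 1])
  have a2 := close (max N 1) (by linarith [le_max_right N 1])
  have b1 := hN T ((le_max_left _ _).trans hT)
  have b2 := hN (max N 1) (le_max_left _ _)
  rw [Real.dist_eq, abs_lt] at *
  rw [abs_le] at a1 a2
  constructor <;> linarith [a1.1, a1.2, a2.1, a2.2, b1.1, b1.2, b2.1, b2.2]

/-- `‖P‖ = (lim_{T → ∞} T⁻¹ ∫_0^T |P(it)|^p dt)^{1/p}`; the limit exists by
`exists_tendsto_meanPow`. -/
def meanNorm (p : ℝ) (P : ℕ+ →₀ ℂ) : ℝ :=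
  (limUnder atTop fun T : ℝ =>
    T⁻¹ * ∫ t in (0 : ℝ)..T, ‖dirichletEval P (t * Complex.I)‖ ^ p) ^ (1 / p)

theorem tendsto_meanNorm {p : ℝ} (hp : 1 ≤ p) (P : ℕ+ →₀ ℂ) :
    Tendsto (fun T => meanPow p P T ^ (1 / p)) atTop (𝓝 (meanNorm p P)) := by
  have h := tendsto_nhds_limUnder (exists_tendsto_meanPow hp P)
  exact h.rpow_const (Or.inr (by positivity))

theorem meanPow_nonneg {p : ℝ} (P : ℕ+ →₀ ℂ) {T : ℝ} (hT : 0 < T) : 0 ≤ meanPow p P T :=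
  mul_nonneg (inv_pos.2 hT).le (intervalIntegral.integral_nonneg hT.le fun t _ => by positivity)

theorem meanNorm_nonneg {p : ℝ} (hp : 1 ≤ p) (P : ℕ+ →₀ ℂ) : 0 ≤ meanNorm p P := by
  refine ge_of_tendsto (tendsto_meanNorm hp P) ?_
  filter_upwards [eventually_gt_atTop (0 : ℝ)] with T hT
  exact Real.rpow_nonneg (meanPow_nonneg P hT) _

theorem dirichletEval_add (P Q : ℕ+ →₀ ℂ) (s : ℂ) :
    dirichletEval (P + Q) s = dirichletEval P s + dirichletEval Q s :=
  Finsupp.sum_add_index' (by simp) (by intros; ring)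

theorem dirichletEval_smul (a : ℂ) (P : ℕ+ →₀ ℂ) (s : ℂ) :
    dirichletEval (a • P) s = a * dirichletEval P s := by
  unfold dirichletEval
  rw [Finsupp.sum_smul_index (by simp), Finsupp.mul_sum]
  simp only [mul_assoc]

theorem meanNorm_smul {p : ℝ} (hp : 1 ≤ p) (a : ℂ) (P : ℕ+ →₀ ℂ) :
    meanNorm p (a • P) = ‖a‖ * meanNorm p P := by
  refine tendsto_nhds_unique (tendsto_meanNorm hp _)
    (((tendsto_meanNorm hp P).const_mul ‖a‖).congr' ?_)
  filter_upwards [eventually_gt_atTop (0 : ℝ)] with T hT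
  have : meanPow p (a • P) T = ‖a‖ ^ p * meanPow p P T := by
    unfold meanPow
    simp only [dirichletEval_smul, norm_mul, Real.mul_rpow (norm_nonneg _) (norm_nonneg _),
      intervalIntegral.integral_const_mul]
    ring
  rw [this, Real.mul_rpow (by positivity) (meanPow_nonneg P hT), ← Real.rpow_mul (norm_nonneg _),
    mul_one_div_cancel (by linarith), Real.rpow_one]

theorem meanNorm_add_le {p : ℝ} (hp : 1 ≤ p) (P Q : ℕ+ →₀ ℂ) :
    meanNorm p (P + Q) ≤ meanNorm p P + meanNorm p Q := by
  refine le_of_tendsto_of_tendsto (tendsto_meanNorm hp _)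
    ((tendsto_meanNorm hp P).add (tendsto_meanNorm hp Q)) ?_
  filter_upwards [eventually_gt_atTop (0 : ℝ)] with T hT
  have hp0 : 0 < p := by linarith
  have key : ∀ R : ℕ+ →₀ ℂ, meanPow p R T ^ (1 / p) = T⁻¹ ^ (1 / p) *
      lpNorm (fun t : ℝ => dirichletEval R (t * Complex.I)) (ENNReal.ofReal p)
        (volume.restrict (Ioc 0 T)) := by
    intro R
    rw [lpNorm_eq_integral_norm_rpow_toReal (by simpa using hp0) ENNReal.ofReal_ne_top
      (MeanAux.continuous_eval R).aestronglyMeasurable, ENNReal.toReal_ofReal hp0.le, meanPow,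
      Real.mul_rpow (inv_pos.2 hT).le (intervalIntegral.integral_nonneg hT.le
        fun t _ => by positivity), intervalIntegral.integral_of_le hT.le, one_div]
  have hmem : MemLp (fun t : ℝ => dirichletEval P (t * Complex.I)) (ENNReal.ofReal p)
      (volume.restrict (Ioc 0 T)) :=
    MemLp.of_bound (MeanAux.continuous_eval P).aestronglyMeasurable _
      (ae_of_all _ (MeanAux.norm_eval_le P))
  rw [key, key, key, ← mul_add]
  refine mul_le_mul_of_nonneg_left ?_ (by positivity)
  have h := lpNorm_add_le hmem (g := fun t : ℝ => dirichletEval Q (t * Complex.I))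
    (by simpa using ENNReal.ofReal_le_ofReal hp)
  refine le_trans (le_of_eq ?_) h
  congr 1
  ext t
  exact dirichletEval_add P Q _

/-- The space of Dirichlet polynomials, normed by `meanNorm p`. -/
def DirichletPolynomial (p : ℝ) [Fact (1 ≤ p)] : Type := ℕ+ →₀ ℂ

section Spaces

variable (p : ℝ) [Fact (1 ≤ p)]

instance : AddCommGroup (DirichletPolynomial p) := inferInstanceAs (AddCommGroup (ℕ+ →₀ ℂ))
instance : Module ℂ (DirichletPolynomial p) := inferInstanceAs (Module ℂ (ℕ+ →₀ ℂ))
instance : Norm (DirichletPolynomial p) := ⟨meanNorm p⟩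

theorem DirichletPolynomial.core : SeminormedSpace.Core ℂ (DirichletPolynomial p) where
  norm_nonneg P := meanNorm_nonneg Fact.out P
  norm_smul a P := meanNorm_smul Fact.out a P
  norm_triangle P Q := meanNorm_add_le Fact.out P Q

instance : SeminormedAddCommGroup (DirichletPolynomial p) :=
  SeminormedAddCommGroup.ofCore (DirichletPolynomial.core p)

instance : NormedSpace ℂ (DirichletPolynomial p) where
  norm_smul_le a P := (meanNorm_smul Fact.out a P).le

/-- The Banach space `ℋ^p` of Dirichlet series: the completion of the Dirichlet polynomials. -/
abbrev HardyDirichlet : Type := UniformSpace.Completion (DirichletPolynomial p)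

end Spaces

/-- The half-plane `ℂ_θ = {s : Re s > θ}`. -/
def halfPlane (θ : ℝ) : Set ℂ := {s | θ < s.re}

section Evaluation

variable {p : ℝ} [Fact (1 ≤ p)]

/-- The value `f(s)` of `f ∈ ℋ^p` at a point `s` of `ℂ_{1/2}`: the continuous extension to the
completion of the evaluation `P ↦ P(s)` of Dirichlet polynomials, which for `Re s > 1/2` is a
bounded functional. Only used for `s ∈ ℂ_{1/2}`. -/
def pointEval (s : ℂ) (f : HardyDirichlet p) : ℂ :=
  UniformSpace.Completion.extension (fun P : DirichletPolynomial p => dirichletEval P s) f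

variable (p)

/-- The norm of the functional `δ_s : f ↦ f(s)` on `ℋ^p`. -/
def pointEvalNorm (s : ℂ) : ℝ≥0∞ :=
  ⨆ (f : HardyDirichlet p) (_ : ‖f‖ ≤ 1), ‖pointEval s f‖ₑ

/-- The `ℋ^p` Carleson norm of a measure on `ℂ_{1/2}`: the smallest `C` with
`∫ |f|^p dμ ≤ C ‖f‖^p` for all `f ∈ ℋ^p` (and `∞` if there is no finite one). -/
def carlesonNorm (μ : Measure ℂ) : ℝ≥0∞ :=
  sInf {C | ∀ f : HardyDirichlet p,
    ∫⁻ s in halfPlane (1 / 2), ‖pointEval s f‖ₑ ^ p ∂μ ≤ C * ‖f‖ₑ ^ p}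

/-- The measure `μ_S = ∑_j ‖δ_{s_j}‖^{-p} δ_{s_j}`, where the last `δ_{s_j}` is the unit mass. -/
def pointMeasure {ι : Type*} (S : ι → ℂ) : Measure ℂ :=
  Measure.sum fun j => (pointEvalNorm p (S j) ^ p)⁻¹ • Measure.dirac (S j)

variable {p}

/-- `T` is the composition operator `C_φ : f ↦ f ∘ φ` on `ℋ^p` (as functions on `ℂ_{1/2}`). -/
def IsCompositionOperator (φ : ℂ → ℂ) (T : HardyDirichlet p →L[ℂ] HardyDirichlet p) : Prop :=
  ∀ f : HardyDirichlet p, ∀ s ∈ halfPlane (1 / 2), pointEval s (T f) = pointEval (φ s) f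

end Evaluation

/-- `g` is given by the Dirichlet series `∑ b_n n^{-s}` in some half-plane. -/
def HasDirichletSeries (g : ℂ → ℂ) (b : ℕ+ → ℂ) : Prop :=
  ∃ σ : ℝ, ∀ s ∈ halfPlane σ, HasSum (fun n : ℕ+ => b n * (n : ℂ) ^ (-s)) (g s)

/-- `φ` is an analytic self-map of `ℂ_{1/2}` of the form `φ(s) = c₀ s + ∑ c_n n^{-s}`; the Dirichlet
series is only required to converge in some half-plane, `φ` being its analytic continuation. -/
structure IsSymbol (c₀ : ℕ) (c : ℕ+ → ℂ) (φ : ℂ → ℂ) : Prop where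
  mapsTo : MapsTo φ (halfPlane (1 / 2)) (halfPlane (1 / 2))
  differentiableOn : DifferentiableOn ℂ φ (halfPlane (1 / 2))
  series : HasDirichletSeries (fun s => φ s - c₀ * s) c

/-- `h` belongs to `ℋ^∞`: a bounded analytic function on `ℂ_0` given by a Dirichlet series. -/
structure IsHInfty (h : ℂ → ℂ) : Prop where
  differentiableOn : DifferentiableOn ℂ h (halfPlane 0)
  bounded : ∃ B : ℝ, ∀ s ∈ halfPlane 0, ‖h s‖ ≤ B
  series : ∃ b : ℕ+ → ℂ, HasDirichletSeries h b

/-- The `ℋ^∞` constant of interpolation of `S`: the best `K` such that for every bounded `(a_j)`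
there is `h ∈ ℋ^∞` with `h(s_j) = a_j` for all `j` and `‖h‖_∞ ≤ K sup_j |a_j|`. -/
def interpolationConstant {ι : Type*} (S : ι → ℂ) : ℝ≥0∞ :=
  sInf {K | ∀ a : ι → ℂ, BddAbove (range fun j => ‖a j‖) →
    ∃ h : ℂ → ℂ, IsHInfty h ∧ (∀ j, h (S j) = a j) ∧
      ⨆ s ∈ halfPlane 0, ‖h s‖ₑ ≤ K * ⨆ j, ‖a j‖ₑ}

/-- The `n`th approximation number `a_n(T) = inf {‖T - R‖ : rank R < n}`, for `n ≥ 1`. -/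
def approximationNumber {X : Type*} [NormedAddCommGroup X] [NormedSpace ℂ X] (n : ℕ)
    (T : X →L[ℂ] X) : ℝ :=
  sInf {r | ∃ R : X →L[ℂ] X, LinearMap.rank (R : X →ₗ[ℂ] X) < (n : Cardinal) ∧ r = ‖T - R‖}

/-- The Riemann zeta function at a real point `x > 1`, as a real number. -/
def realZeta (x : ℝ) : ℝ := (riemannZeta (x : ℂ)).re

end

end DirichletHardy

open DirichletHardy

/-! The idea is to exhibit, for every `R` of rank less than `n`, a function `f` with `R f = 0` whose
norm is controlled by interpolation and whose image under the composition operator `T` is bounded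
below by the Carleson inequality.

Let `k_j` lie in the unit ball of `ℋ^p` with `|k_j(s_j)|` comparable to `ζ(2 Re s_j)^{1/p}`, and let
`h_j` be a dual system, `h_j(s_l) = δ_{jl}`, with `∑ |h_j|² ≤ M²` on the imaginary axis. The rank
condition supplies `a` with `∑ |a_j|^p = 1` such that `R` kills `f = ∑ a_j h_j k_j`. Cauchy–Schwarz
in `j` and the comparison of `ℓ²` with `ℓ^p` give `‖f‖ ≤ M n^{1/min(2,p) - 1/p}`. On the other side
`T f` takes the value `f(s_l) = a_l k_l(s_l)` at `s'_l`, so the Carleson inequality for `μ_{S'}`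
bounds `‖T f‖ = ‖(T - R) f‖` from below by the ratio of zeta values. This is
`le_norm_sub_mul_of_rank_lt`.

Three ingredients carry this. Point evaluation at `s` has norm between `ζ(2 Re s)^{1/p} / 8` and
`ζ(2 Re s)^{1/p}` (`norm_dirichletEval_le_meanNorm`, `exists_large_dirichletEval`): over the
`N`-smooth numbers the reproducing kernel `K` is a finite Euler product without zeros, so its real
powers exist. Then `K^{2/p}` is nearly extremal, and the reproducing formula for `P K^{1 - 2/p}`
with Hölder gives the upper bound.

The dual system comes from averaging `ℋ^∞` interpolants of the rows of the discrete Fourier matrix;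
orthogonality of that matrix gives both duality and the square function bound with `M` equal to the
interpolation constant (`exists_almost_dual_polynomials`).

Finally, all test functions are kept Dirichlet polynomials, so that norms are means on the imaginary
axis. An `ℋ^∞` function is replaced by a polynomial through Gaussian averaging along vertical lines
(`IsHInfty.exists_dirichletEval`). Duality then holds only up to an `ε`, which is sent to `0` at the
end. -/

namespace DirichletHardy

/-! ### Mean values on the half-line and orthogonality of `n^{-it}` -/

/-- `f` is continuous and has the mean value `m` on the half-line. -/
structure HasMean (f : ℝ → ℂ) (m : ℂ) : Prop where
  cont : Continuous f
  tendsto : Tendsto (fun T : ℝ => (T : ℂ)⁻¹ * ∫ t in (0 : ℝ)..T, f t) atTop (𝓝 m)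

namespace HasMean

theorem zero : HasMean 0 0 := ⟨continuous_zero, by simp⟩

theorem add {f g : ℝ → ℂ} {a b : ℂ} (hf : HasMean f a) (hg : HasMean g b) :
    HasMean (f + g) (a + b) := by
  refine ⟨hf.cont.add hg.cont, (hf.tendsto.add hg.tendsto).congr fun T => ?_⟩
  simp only [Pi.add_apply]
  rw [intervalIntegral.integral_add (hf.cont.intervalIntegrable _ _)
    (hg.cont.intervalIntegrable _ _), mul_add]

theorem const_smul {f : ℝ → ℂ} {a : ℂ} (c : ℂ) (hf : HasMean f a) :
    HasMean (c • f) (c * a) := by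
  refine ⟨hf.cont.const_smul c, (hf.tendsto.const_mul c).congr fun T => ?_⟩
  simp only [Pi.smul_apply, smul_eq_mul, intervalIntegral.integral_const_mul]
  ring

/-- The means of a dominated series of functions add up. -/
theorem tsum {ι : Type*} [Countable ι] {f : ι → ℝ → ℂ} {m : ι → ℂ} {u : ι → ℝ}
    (hu : Summable u) (hf : ∀ i, HasMean (f i) (m i)) (hb : ∀ i t, ‖f i t‖ ≤ u i) :
    HasMean (fun t => ∑' i, f i t) (∑' i, m i) := by
  have key : ∀ T : ℝ, (T : ℂ)⁻¹ * ∫ t in (0 : ℝ)..T, ∑' i, f i t =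
      ∑' i, (T : ℂ)⁻¹ * ∫ t in (0 : ℝ)..T, f i t := by
    intro T
    rw [tsum_mul_left]
    congr 1
    refine ((intervalIntegral.hasSum_integral_of_dominated_convergence (fun i _ => u i)
      (fun i => (hf i).cont.aestronglyMeasurable) (fun i => ae_of_all _ fun t _ => hb i t)
      (ae_of_all _ fun _ _ => hu) intervalIntegrable_const
      (ae_of_all _ fun t _ => ?_)).tsum_eq).symm
    exact (Summable.of_norm_bounded hu fun i => hb i t).hasSum
  refine ⟨continuous_tsum (fun i => (hf i).cont) hu hb, ?_⟩
  simp only [key]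
  refine tendsto_tsum_of_dominated_convergence hu (fun i => (hf i).tendsto) ?_
  filter_upwards [eventually_gt_atTop (0 : ℝ)] with T hT i
  have h := intervalIntegral.norm_integral_le_of_norm_le_const (a := 0) (b := T)
    (fun t _ => hb i t)
  rw [sub_zero, abs_of_pos hT] at h
  rw [norm_mul, norm_inv, Complex.norm_real, Real.norm_of_nonneg hT.le]
  calc T⁻¹ * _ ≤ T⁻¹ * (u i * T) := by gcongr
    _ = u i := by field_simp

theorem exp_mul (l : ℝ) :
    HasMean (fun t : ℝ => Complex.exp (l * Complex.I * t)) (if l = 0 then 1 else 0) := by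
  refine ⟨by fun_prop, ?_⟩
  split_ifs with hl
  · refine tendsto_const_nhds.congr' ?_
    filter_upwards [eventually_gt_atTop (0 : ℝ)] with T hT
    have : (T : ℂ) ≠ 0 := by exact_mod_cast hT.ne'
    simp [hl, this]
  · have hl' : (l : ℂ) * Complex.I ≠ 0 := by simp [hl]
    have hi : Tendsto (fun T : ℝ => (2 / |l|) * T⁻¹) atTop (𝓝 0) := by
      simpa using tendsto_inv_atTop_zero.const_mul (2 / |l|)
    refine squeeze_zero_norm' ?_ hi
    filter_upwards [eventually_gt_atTop (0 : ℝ)] with T hT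
    rw [integral_exp_mul_complex hl', norm_mul, norm_div]
    have h1 : ‖(l : ℂ) * Complex.I‖ = |l| := by simp
    have h2 : ‖Complex.exp (l * Complex.I * T) - Complex.exp (l * Complex.I * (0 : ℝ))‖ ≤ 2 := by
      refine (norm_sub_le _ _).trans ?_
      have e1 : Complex.exp (l * Complex.I * T) = Complex.exp ((l * T : ℝ) * Complex.I) := by
        congr 1; push_cast; ring
      rw [e1, Complex.norm_exp_ofReal_mul_I]
      simp; norm_num
    rw [h1, norm_inv, Complex.norm_real, Real.norm_of_nonneg hT.le, mul_comm]
    gcongr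

end HasMean

theorem natCast_cpow_neg_eq_exp {n : ℕ} (hn : n ≠ 0) (w : ℂ) :
    (n : ℂ) ^ (-w) = Complex.exp (-(Real.log n * w)) := by
  have hn : (n : ℂ) ≠ 0 := by exact_mod_cast hn
  rw [Complex.cpow_def_of_ne_zero hn, ← Complex.natCast_log]
  congr 1; ring

theorem norm_natCast_cpow_neg {n : ℕ} (hn : n ≠ 0) (w : ℂ) :
    ‖(n : ℂ) ^ (-w)‖ = (n : ℝ) ^ (-w.re) := by
  rw [Complex.norm_natCast_cpow_of_pos (Nat.pos_of_ne_zero hn), Complex.neg_re]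

theorem norm_natCast_cpow_neg_le_one {n : ℕ} (hn : n ≠ 0) {w : ℂ} (hw : 0 ≤ w.re) :
    ‖(n : ℂ) ^ (-w)‖ ≤ 1 := by
  rw [norm_natCast_cpow_neg hn]
  exact Real.rpow_le_one_of_one_le_of_nonpos (by exact_mod_cast Nat.one_le_iff_ne_zero.2 hn)
    (by simpa using hw)

/-- Orthogonality of the functions `n^{-it}`. -/
theorem hasMean_cpow_mul_star {m n : ℕ} (hm : m ≠ 0) (hn : n ≠ 0) :
    HasMean (fun t : ℝ => (n : ℂ) ^ (-(t * Complex.I)) * star ((m : ℂ) ^ (-(t * Complex.I))))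
      (if m = n then 1 else 0) := by
  have h := HasMean.exp_mul (Real.log m - Real.log n)
  have e : Real.log m - Real.log n = 0 ↔ m = n := by
    rw [sub_eq_zero]
    constructor
    · intro h
      have := Real.log_injOn_pos (show (m : ℝ) ∈ Ioi 0 by simpa using Nat.pos_of_ne_zero hm)
        (show (n : ℝ) ∈ Ioi 0 by simpa using Nat.pos_of_ne_zero hn) h
      exact_mod_cast this
    · rintro rfl; rfl
  simp only [e] at h
  convert h using 2 with t
  rw [natCast_cpow_neg_eq_exp hm, natCast_cpow_neg_eq_exp hn, Complex.star_def,
    ← Complex.exp_conj, ← Complex.exp_add]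
  congr 1
  simp only [map_mul, map_neg, Complex.conj_ofReal, Complex.conj_I]
  push_cast; ring

/-! ### Dirichlet polynomials over smooth numbers and their uniform limits -/

/-- The algebra of Dirichlet polynomials supported on `N`-smooth numbers. -/
def smoothAlg (N : ℕ) : Subalgebra ℂ (ℂ → ℂ) :=
  Algebra.adjoin ℂ (range fun (n : N.smoothNumbers) (w : ℂ) => ((n : ℕ) : ℂ) ^ (-w))

theorem cpow_mem_smoothAlg {N n : ℕ} (hn : n ∈ N.smoothNumbers) :
    (fun w : ℂ => (n : ℂ) ^ (-w)) ∈ smoothAlg N :=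
  Algebra.subset_adjoin ⟨⟨n, hn⟩, rfl⟩

/-- Smooth numbers are closed under multiplication, so the functions `n^{-w}` already form a monoid
and the algebra they generate is just their linear span. -/
theorem smoothAlg_induction {N : ℕ} {p : (ℂ → ℂ) → Prop}
    (mem : ∀ n ∈ N.smoothNumbers, p fun w => (n : ℂ) ^ (-w)) (zero : p 0)
    (add : ∀ f g, p f → p g → p (f + g)) (smul : ∀ (a : ℂ) f, p f → p (a • f))
    {F : ℂ → ℂ} (hF : F ∈ smoothAlg N) : p F := by
  set E := range fun (n : N.smoothNumbers) (w : ℂ) => ((n : ℕ) : ℂ) ^ (-w) with hE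
  have hsub : (Submonoid.closure E : Set (ℂ → ℂ)) ⊆ Submodule.span ℂ E := by
    let M : Submonoid (ℂ → ℂ) :=
      { carrier := E
        one_mem' := ⟨⟨1, by simp [Nat.mem_smoothNumbers]⟩, by ext; simp⟩
        mul_mem' := by
          rintro _ _ ⟨l, rfl⟩ ⟨k, rfl⟩
          refine ⟨⟨l * k, Nat.mul_mem_smoothNumbers l.2 k.2⟩, ?_⟩
          ext w
          simp [Complex.natCast_mul_natCast_cpow] }
    have : Submonoid.closure E ≤ M := Submonoid.closure_le.2 (fun x hx => hx)
    exact fun x hx => Submodule.subset_span (this hx)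
  have h : F ∈ Submodule.span ℂ E := by
    rw [← Algebra.adjoin_eq_span_of_subset ℂ hsub]
    exact hF
  clear hF
  induction h using Submodule.span_induction with
  | mem x hx => obtain ⟨n, rfl⟩ := hx; exact mem n n.2
  | zero => exact zero
  | add x y _ _ h1 h2 => exact add _ _ h1 h2
  | smul a x _ h1 => exact smul _ _ h1

theorem exists_dirichletEval_eq {N : ℕ} {F : ℂ → ℂ} (hF : F ∈ smoothAlg N) :
    ∃ P : ℕ+ →₀ ℂ, dirichletEval P = F := by
  refine smoothAlg_induction (p := fun F => ∃ P : ℕ+ →₀ ℂ, dirichletEval P = F)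
    (fun n hn => ?_) ?_ ?_ ?_ hF
  · refine ⟨Finsupp.single ⟨n, Nat.pos_of_ne_zero hn.1⟩ 1, ?_⟩
    ext w
    exact (Finsupp.sum_single_index (by simp)).trans (by simp)
  · exact ⟨0, by ext; simp [dirichletEval]⟩
  · rintro _ _ ⟨P, rfl⟩ ⟨Q, rfl⟩
    exact ⟨P + Q, by ext; simp [dirichletEval_add]⟩
  · rintro a _ ⟨P, rfl⟩
    exact ⟨a • P, by ext; simp [dirichletEval_smul]⟩

theorem exists_mem_smoothAlg (P : ℕ+ →₀ ℂ) : ∃ N₀ : ℕ, ∀ N ≥ N₀,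
    dirichletEval P ∈ smoothAlg N := by
  refine ⟨(P.support.sup fun n => (n : ℕ)) + 1, fun N hN => ?_⟩
  have : dirichletEval P = ∑ n ∈ P.support, P n • fun w : ℂ => ((n : ℕ) : ℂ) ^ (-w) := by
    ext w
    simp [dirichletEval, Finsupp.sum]
  rw [this]
  refine Subalgebra.sum_mem _ fun n hn => Subalgebra.smul_mem _ (cpow_mem_smoothAlg ?_) _
  refine Nat.mem_smoothNumbers_of_lt n.pos ?_
  have : (n : ℕ) ≤ _ := Finset.le_sup (f := fun n : ℕ+ => (n : ℕ)) hn
  omega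

theorem norm_dirichletEval_le (P : ℕ+ →₀ ℂ) {w : ℂ} (hw : 0 ≤ w.re) :
    ‖dirichletEval P w‖ ≤ ∑ n ∈ P.support, ‖P n‖ := by
  unfold dirichletEval Finsupp.sum
  refine (norm_sum_le _ _).trans (Finset.sum_le_sum fun n _ => ?_)
  rw [norm_mul]
  exact mul_le_of_le_one_right (norm_nonneg _) (norm_natCast_cpow_neg_le_one n.ne_zero hw)

theorem exists_bound_of_mem_smoothAlg {N : ℕ} {F : ℂ → ℂ} (hF : F ∈ smoothAlg N) :
    ∃ B : ℝ, ∀ w : ℂ, 0 ≤ w.re → ‖F w‖ ≤ B := by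
  obtain ⟨P, rfl⟩ := exists_dirichletEval_eq hF
  exact ⟨_, fun w hw => norm_dirichletEval_le P hw⟩

/-- Products of Dirichlet polynomials are Dirichlet polynomials. -/
theorem exists_dirichletEval_mul (P Q : ℕ+ →₀ ℂ) :
    ∃ R : ℕ+ →₀ ℂ, ∀ w, dirichletEval R w = dirichletEval P w * dirichletEval Q w := by
  obtain ⟨N, hN⟩ := exists_mem_smoothAlg P
  obtain ⟨M, hM⟩ := exists_mem_smoothAlg Q
  obtain ⟨R, hR⟩ := exists_dirichletEval_eq
    (mul_mem (hN (max N M) (le_max_left _ _)) (hM (max N M) (le_max_right _ _)))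
  exact ⟨R, fun w => congrFun hR w⟩

/-- `F` is a uniform limit on `Re w ≥ 0` of Dirichlet polynomials supported on `N`-smooth
numbers. -/
def UnifApprox (N : ℕ) (f : ℂ → ℂ) : Prop :=
  ∀ ε > 0, ∃ F ∈ smoothAlg N, ∀ w : ℂ, 0 ≤ w.re → ‖F w - f w‖ ≤ ε

theorem UnifApprox.bound {N : ℕ} {f : ℂ → ℂ} (hf : UnifApprox N f) :
    ∃ B : ℝ, 0 ≤ B ∧ ∀ w : ℂ, 0 ≤ w.re → ‖f w‖ ≤ B := by
  obtain ⟨F, hF, h⟩ := hf 1 one_pos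
  obtain ⟨B, hB⟩ := exists_bound_of_mem_smoothAlg hF
  have : ∀ w : ℂ, 0 ≤ w.re → ‖f w‖ ≤ B + 1 := fun w hw => by
    have e : f w = F w - (F w - f w) := by ring
    rw [e]
    exact (norm_sub_le _ _).trans (add_le_add (hB w hw) (h w hw))
  exact ⟨B + 1, (norm_nonneg _).trans (this 0 le_rfl), this⟩

theorem UnifApprox.mul {N : ℕ} {f g : ℂ → ℂ} (hf : UnifApprox N f) (hg : UnifApprox N g) :
    UnifApprox N (f * g) := by
  intro ε hε
  obtain ⟨A, hA0, hA⟩ := hf.bound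
  obtain ⟨B, hB0, hB⟩ := hg.bound
  -- The cap `1` gives `‖F‖ ≤ A + 1`; the other term makes the total error `δ (A + 1 + B)` at most
  -- `ε`.
  have hδ : 0 < min 1 (ε / (A + 1 + B)) := by positivity
  set δ := min 1 (ε / (A + 1 + B))
  obtain ⟨F, hF, hFf⟩ := hf δ hδ
  obtain ⟨G, hG, hGg⟩ := hg δ hδ
  refine ⟨F * G, mul_mem hF hG, fun w hw => ?_⟩
  have e : (F * G) w - (f * g) w = F w * (G w - g w) + (F w - f w) * g w := by
    simp only [Pi.mul_apply]; ring
  have hFb : ‖F w‖ ≤ A + 1 := by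
    have e : F w = f w + (F w - f w) := by ring
    rw [e]
    exact (norm_add_le _ _).trans (add_le_add (hA w hw) ((hFf w hw).trans (min_le_left _ _)))
  rw [e]
  refine (norm_add_le _ _).trans ?_
  rw [norm_mul, norm_mul]
  calc _ ≤ (A + 1) * δ + δ * B := by
        gcongr
        exacts [hGg w hw, hFf w hw, hB w hw]
    _ = δ * (A + 1 + B) := by ring
    _ ≤ ε / (A + 1 + B) * (A + 1 + B) := by gcongr; exact min_le_right _ _
    _ = ε := by field_simp

theorem UnifApprox.prod {N : ℕ} {ι : Type*} (s : Finset ι) {f : ι → ℂ → ℂ}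
    (hf : ∀ i ∈ s, UnifApprox N (f i)) : UnifApprox N (fun w => ∏ i ∈ s, f i w) := by
  classical
  induction s using Finset.induction_on with
  | empty =>
    intro ε hε
    exact ⟨1, one_mem _, fun w _ => by simpa using hε.le⟩
  | insert i s hi ih =>
    simp only [Finset.prod_insert hi]
    exact (hf i (Finset.mem_insert_self _ _)).mul
      (ih fun j hj => hf j (Finset.mem_insert_of_mem hj))

/-- Functions analytic in the unit disc operate on `UnifApprox`. -/
theorem UnifApprox.comp {N : ℕ} {g : ℂ → ℂ} (hg : DifferentiableOn ℂ g (Metric.ball 0 1))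
    {f : ℂ → ℂ} (hf : f ∈ smoothAlg N) {r : ℝ} (hr0 : 0 ≤ r) (hr : r < 1)
    (hfr : ∀ w : ℂ, 0 ≤ w.re → ‖f w‖ ≤ r) :
    UnifApprox N (fun w => g (f w)) := by
  intro ε hε
  -- With `r < r' < R < 1`, the Taylor series of `g` exists on the disc of radius `R` and converges
  -- uniformly on that of radius `r'`, which contains the values of `f`. Its partial sums are
  -- polynomials in `f`, hence stay in the algebra.
  obtain ⟨r', hr', hr'1⟩ := exists_between hr
  obtain ⟨R, hR', hR1⟩ := exists_between hr'1
  have hps := DifferentiableOn.hasFPowerSeriesOnBall (R := ⟨R, by linarith⟩) (c := 0)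
    (hg.mono (Metric.closedBall_subset_ball (by exact hR1))) (by
      change (0 : ℝ) < R; linarith)
  have hu := hps.tendstoUniformlyOn (r' := ⟨r', by linarith⟩) (ENNReal.coe_lt_coe.2 (NNReal.coe_lt_coe.1 hR'))
  rw [Metric.tendstoUniformlyOn_iff] at hu
  obtain ⟨n, hn⟩ := (hu ε hε).exists
  set q := cauchyPowerSeries g 0 (R : ℝ)
  refine ⟨∑ k ∈ Finset.range n, (q.coeff k) • f ^ k,
    Subalgebra.sum_mem _ fun k _ => Subalgebra.smul_mem _ (pow_mem hf k) _, fun w hw => ?_⟩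
  have h := hn (f w) (by
    rw [mem_ball_zero_iff]
    exact (hfr w hw).trans_lt hr')
  rw [zero_add, dist_comm, dist_eq_norm] at h
  refine le_trans (le_of_eq ?_) h.le
  congr 2
  simp only [FormalMultilinearSeries.partialSum, Finset.sum_apply, Pi.smul_apply, Pi.pow_apply,
    smul_eq_mul]
  refine Finset.sum_congr rfl fun k _ => ?_
  rw [FormalMultilinearSeries.apply_eq_pow_smul_coeff, smul_eq_mul, mul_comm]
  rfl

/-! ### The reproducing kernel over smooth numbers and its powers -/

/-- The reproducing kernel at `s` of the Dirichlet series over `N`-smooth numbers. -/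
noncomputable def smoothKernel (N : ℕ) (s w : ℂ) : ℂ :=
  ∏ q ∈ N.primesBelow, (1 - (q : ℂ) ^ (-(star s + w)))⁻¹

/-- The value `∏_{q < N} (1 - q^{-2σ})⁻¹` of the kernel on the diagonal. -/
noncomputable def partialZeta (N : ℕ) (x : ℝ) : ℝ :=
  ∏ q ∈ N.primesBelow, (1 - (q : ℝ) ^ (-x))⁻¹

theorem natCast_cpow_add_neg {n : ℕ} (hn : n ≠ 0) (z w : ℂ) :
    (n : ℂ) ^ (-(z + w)) = (n : ℂ) ^ (-z) * (n : ℂ) ^ (-w) := by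
  rw [neg_add, Complex.cpow_add _ _ (by exact_mod_cast hn)]

theorem star_natCast_cpow (n : ℕ) (z : ℂ) : star ((n : ℂ) ^ z) = (n : ℂ) ^ (star z) := by
  have h := Complex.cpow_conj (n : ℂ) z (by rw [Complex.natCast_arg]; positivity)
  rw [Complex.conj_natCast] at h
  exact h.symm

theorem norm_prime_cpow_lt_one {q : ℕ} (hq : q.Prime) {z : ℂ} (hz : 0 < z.re) :
    ‖(q : ℂ) ^ (-z)‖ < 1 := by
  rw [norm_natCast_cpow_neg hq.ne_zero]
  exact Real.rpow_lt_one_of_one_lt_of_neg (by exact_mod_cast hq.one_lt) (by simpa using hz)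

/-- Only finitely many primes are involved, so the Euler product expands absolutely for all `Re z >
0`, not merely for `Re z > 1`. This makes the truncated kernel available up to the imaginary axis.
-/
theorem hasSum_smooth (N : ℕ) {z : ℂ} (hz : 0 < z.re) :
    (Summable fun m : N.smoothNumbers => ‖((m : ℕ) : ℂ) ^ (-z)‖) ∧
    HasSum (fun m : N.smoothNumbers => ((m : ℕ) : ℂ) ^ (-z))
      (∏ q ∈ N.primesBelow, (1 - (q : ℂ) ^ (-z))⁻¹) := by
  have hz0 : z ≠ 0 := by rintro rfl; simp at hz
  exact EulerProduct.summable_and_hasSum_smoothNumbers_prod_primesBelow_geometric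
    (f := (riemannZetaSummandHom hz0 : ℕ →* ℂ)) (fun hp => norm_prime_cpow_lt_one hp hz) N

theorem smoothKernel_eq_tsum (N : ℕ) {s w : ℂ} (hs : 0 < s.re) (hw : 0 ≤ w.re) :
    smoothKernel N s w =
      ∑' m : N.smoothNumbers, ((m : ℕ) : ℂ) ^ (-star s) * ((m : ℕ) : ℂ) ^ (-w) := by
  rw [smoothKernel, ← (hasSum_smooth N (z := star s + w) (by simp; linarith)).2.tsum_eq]
  exact tsum_congr fun m => natCast_cpow_add_neg m.2.1 _ _

theorem smoothKernel_self (N : ℕ) (s : ℂ) :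
    smoothKernel N s s = (partialZeta N (2 * s.re) : ℂ) := by
  have h : star s + s = ((2 * s.re : ℝ) : ℂ) := by
    rw [add_comm, Complex.star_def, Complex.add_conj]
  rw [smoothKernel, partialZeta, h]
  push_cast
  refine Finset.prod_congr rfl fun q _ => ?_
  rw [Complex.ofReal_cpow (Nat.cast_nonneg _)]
  push_cast
  rfl

theorem one_le_partialZeta_factor {q : ℕ} (hq : q.Prime) {x : ℝ} (hx : 0 < x) :
    1 ≤ (1 - (q : ℝ) ^ (-x))⁻¹ := by
  have h1 : (q : ℝ) ^ (-x) < 1 :=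
    Real.rpow_lt_one_of_one_lt_of_neg (by exact_mod_cast hq.one_lt) (by simpa using hx)
  have h0 : 0 ≤ (q : ℝ) ^ (-x) := by positivity
  exact (one_le_inv₀ (by linarith)).2 (by linarith)

theorem one_le_partialZeta (N : ℕ) {x : ℝ} (hx : 0 < x) : 1 ≤ partialZeta N x :=
  Finset.one_le_prod fun _ hq => one_le_partialZeta_factor (Nat.prime_of_mem_primesBelow hq) hx

theorem partialZeta_mono {x : ℝ} (hx : 0 < x) : Monotone fun N => partialZeta N x := by
  intro M N h
  refine Finset.prod_le_prod_of_subset_of_one_le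
    (Finset.filter_subset_filter _ (Finset.range_mono h)) (fun q hq => ?_) fun q hq _ => ?_
  · exact zero_le_one.trans (one_le_partialZeta_factor (Nat.prime_of_mem_primesBelow hq) hx)
  · exact one_le_partialZeta_factor (Nat.prime_of_mem_primesBelow hq) hx

theorem tendsto_partialZeta {x : ℝ} (hx : 1 < x) :
    Tendsto (fun N => partialZeta N x) atTop (𝓝 (realZeta x)) := by
  have h := (Complex.continuous_re.tendsto _).comp
    (riemannZeta_eulerProduct (s := (x : ℂ)) (by simpa using hx))
  refine h.congr fun N => ?_
  simp only [Function.comp, partialZeta]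
  rw [← Complex.ofReal_re (∏ q ∈ N.primesBelow, (1 - (q : ℝ) ^ (-x))⁻¹)]
  push_cast
  congr 1
  refine Finset.prod_congr rfl fun q _ => ?_
  rw [Complex.ofReal_cpow (Nat.cast_nonneg _)]
  push_cast
  rfl

theorem partialZeta_le_realZeta (N : ℕ) {x : ℝ} (hx : 1 < x) : partialZeta N x ≤ realZeta x :=
  (partialZeta_mono (by linarith)).ge_of_tendsto (tendsto_partialZeta hx) N

theorem one_le_realZeta {x : ℝ} (hx : 1 < x) : 1 ≤ realZeta x :=
  (one_le_partialZeta 0 (by linarith)).trans (partialZeta_le_realZeta 0 hx)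

theorem summable_norm_smooth (N : ℕ) {s : ℂ} (hs : 0 < s.re) :
    Summable fun m : N.smoothNumbers => ‖((m : ℕ) : ℂ) ^ (-star s)‖ :=
  (hasSum_smooth N (z := star s) (by simpa using hs)).1

/-- The reproducing property of the kernel. -/
theorem hasMean_cpow_mul_kernel {N n : ℕ} (hn : n ∈ N.smoothNumbers) {s : ℂ} (hs : 0 < s.re) :
    HasMean (fun t : ℝ => (n : ℂ) ^ (-(t * Complex.I)) * star (smoothKernel N s (t * Complex.I)))
      ((n : ℂ) ^ (-s)) := by
  have hre : ∀ t : ℝ, 0 ≤ ((t : ℂ) * Complex.I).re := fun t => by simp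
  have h := HasMean.tsum (summable_norm_smooth N hs)
    (fun m : N.smoothNumbers => (hasMean_cpow_mul_star m.2.1 hn.1).const_smul
      (star (((m : ℕ) : ℂ) ^ (-star s)))) (fun m t => by
      simp only [Pi.smul_apply, smul_eq_mul, norm_mul, norm_star]
      refine mul_le_of_le_one_right (norm_nonneg _) (mul_le_one₀ ?_ (norm_nonneg _) ?_)
      · exact norm_natCast_cpow_neg_le_one hn.1 (hre t)
      · exact norm_natCast_cpow_neg_le_one m.2.1 (hre t))
  convert h using 1
  · ext t
    rw [smoothKernel_eq_tsum N hs (hre t), tsum_star, ← tsum_mul_left]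
    refine tsum_congr fun m => ?_
    simp only [Pi.smul_apply, smul_eq_mul, star_mul']
    ring
  · rw [tsum_eq_single ⟨n, hn⟩ (fun m hm => by
      rw [if_neg (fun h => hm (Subtype.ext h)), mul_zero])]
    simp [star_natCast_cpow]

/-- The reproducing formula extends by linearity from the monomials `n^{-w}`, which span the
algebra. -/
theorem hasMean_mul_kernel {N : ℕ} {F : ℂ → ℂ} (hF : F ∈ smoothAlg N) {s : ℂ} (hs : 0 < s.re) :
    HasMean (fun t : ℝ => F (t * Complex.I) * star (smoothKernel N s (t * Complex.I))) (F s) := by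
  refine smoothAlg_induction (p := fun F => HasMean (fun t : ℝ => F (t * Complex.I) *
    star (smoothKernel N s (t * Complex.I))) (F s)) (fun n hn => ?_) ?_ ?_ ?_ hF
  · exact hasMean_cpow_mul_kernel hn hs
  · simpa using! HasMean.zero
  · intro f g hf hg
    simpa [add_mul] using! hf.add hg
  · intro a f hf
    simpa [mul_assoc] using! hf.const_smul a

theorem norm_smoothKernel_le (N : ℕ) {s w : ℂ} (hs : 0 < s.re) (hw : 0 ≤ w.re) :
    ‖smoothKernel N s w‖ ≤ ∑' m : N.smoothNumbers, ‖((m : ℕ) : ℂ) ^ (-star s)‖ := by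
  rw [smoothKernel_eq_tsum N hs hw]
  refine tsum_of_norm_bounded (summable_norm_smooth N hs).hasSum fun m => ?_
  rw [norm_mul]
  exact mul_le_of_le_one_right (norm_nonneg _) (norm_natCast_cpow_neg_le_one m.2.1 hw)

/-- Expanding the first factor into its absolutely convergent series and reproducing term by term
returns the kernel at its own point `s`. -/
theorem hasMean_normSq_kernel (N : ℕ) {s : ℂ} (hs : 0 < s.re) :
    HasMean (fun t : ℝ => smoothKernel N s (t * Complex.I) *
      star (smoothKernel N s (t * Complex.I))) (partialZeta N (2 * s.re) : ℂ) := by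
  have hre : ∀ t : ℝ, 0 ≤ ((t : ℂ) * Complex.I).re := fun t => by simp
  set B := ∑' m : N.smoothNumbers, ‖((m : ℕ) : ℂ) ^ (-star s)‖
  have h := HasMean.tsum ((summable_norm_smooth N hs).mul_right B)
    (fun m : N.smoothNumbers => (hasMean_cpow_mul_kernel m.2 hs).const_smul
      (((m : ℕ) : ℂ) ^ (-star s))) (fun m t => by
      simp only [Pi.smul_apply, smul_eq_mul, norm_mul, norm_star]
      refine mul_le_mul_of_nonneg_left ?_ (norm_nonneg _)
      refine le_trans (mul_le_of_le_one_left (norm_nonneg _)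
        (norm_natCast_cpow_neg_le_one m.2.1 (hre t))) (norm_smoothKernel_le N hs (hre t)))
  convert h using 1
  · ext t
    nth_rw 1 [smoothKernel_eq_tsum N hs (hre t)]
    rw [← tsum_mul_right]
    refine tsum_congr fun m => ?_
    simp only [Pi.smul_apply, smul_eq_mul]
    ring
  · rw [← smoothKernel_self, smoothKernel_eq_tsum N hs hs.le]

theorem tendsto_mean_norm_kernel (N : ℕ) {s : ℂ} (hs : 0 < s.re) :
    Continuous (fun t : ℝ => smoothKernel N s (t * Complex.I)) ∧
    Tendsto (fun T : ℝ => T⁻¹ * ∫ t in (0 : ℝ)..T, ‖smoothKernel N s (t * Complex.I)‖ ^ 2) atTop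
      (𝓝 (partialZeta N (2 * s.re))) := by
  constructor
  · have := (hasMean_cpow_mul_kernel (N := N) (n := 1) (by simp [Nat.mem_smoothNumbers]) hs).cont
    simp only [Nat.cast_one, Complex.one_cpow, one_mul] at this
    simpa using this.star
  · refine ((Complex.continuous_re.tendsto _).comp (hasMean_normSq_kernel N hs).tendsto).congr
      fun T => ?_
    have e : ∀ t : ℝ, smoothKernel N s (t * Complex.I) * star (smoothKernel N s (t * Complex.I)) =
        ((‖smoothKernel N s (t * Complex.I)‖ ^ 2 : ℝ) : ℂ) := fun t => by
      rw [Complex.star_def, Complex.mul_conj']; push_cast; rfl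
    simp only [Function.comp, e, intervalIntegral.integral_ofReal, ← Complex.ofReal_inv,
      ← Complex.ofReal_mul, Complex.ofReal_re]

/-- The power `K^α` of the kernel `K` at `s`. -/
noncomputable def kernelPow (N : ℕ) (α : ℝ) (s w : ℂ) : ℂ :=
  ∏ q ∈ N.primesBelow, (1 - (q : ℂ) ^ (-(star s + w))) ^ ((-α : ℝ) : ℂ)

/-- The power is taken factor by factor with the principal branch; since the exponent is real, the
modulus does not depend on the branch. -/
theorem norm_kernelPow (N : ℕ) (α : ℝ) (s w : ℂ) :
    ‖kernelPow N α s w‖ = ‖smoothKernel N s w‖ ^ α := by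
  rw [kernelPow, smoothKernel, norm_prod, norm_prod,
    ← Real.finsetProd_rpow _ _ (fun _ _ => norm_nonneg _)]
  refine Finset.prod_congr rfl fun q _ => ?_
  rw [Complex.norm_cpow_real, norm_inv, Real.rpow_neg (norm_nonneg _),
    Real.inv_rpow (norm_nonneg _)]

/-- Each factor is `(1 - z)^{-α}`, analytic in the unit disc, at `z = q^{-(s̄ + w)}`, and `|z| ≤
q^{-Re s} < 1` throughout `Re w ≥ 0`. -/
theorem unifApprox_kernelPow (N : ℕ) (α : ℝ) {s : ℂ} (hs : 0 < s.re) :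
    UnifApprox N (kernelPow N α s) := by
  refine UnifApprox.prod _ fun q hq => ?_
  have hqp := Nat.prime_of_mem_primesBelow hq
  have hs' : 0 < (star s).re := by simpa using hs
  refine UnifApprox.comp (g := fun z => (1 - z) ^ ((-α : ℝ) : ℂ))
    (f := fun w => (q : ℂ) ^ (-(star s + w))) (r := ‖(q : ℂ) ^ (-star s)‖) ?_ ?_ (norm_nonneg _)
    (norm_prime_cpow_lt_one hqp hs') ?_
  · intro z hz
    refine DifferentiableAt.differentiableWithinAt ?_
    refine DifferentiableAt.cpow (by fun_prop) (by fun_prop) ?_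
    rw [mem_ball_zero_iff] at hz
    left
    have := (abs_le.1 (Complex.abs_re_le_norm z)).2
    simp; linarith
  · have : (fun w => (q : ℂ) ^ (-(star s + w))) =
        (q : ℂ) ^ (-star s) • fun w => (q : ℂ) ^ (-w) := by
      ext w
      exact natCast_cpow_add_neg hqp.ne_zero _ _
    rw [this]
    refine Subalgebra.smul_mem _ (cpow_mem_smoothAlg ?_) _
    rw [Nat.mem_smoothNumbers']
    intro p hp hpq
    rw [(Nat.prime_dvd_prime_iff_eq hp hqp).1 hpq]
    exact Nat.lt_of_mem_primesBelow hq
  · intro w hw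
    rw [natCast_cpow_add_neg hqp.ne_zero, norm_mul]
    exact mul_le_of_le_one_right (norm_nonneg _) (norm_natCast_cpow_neg_le_one hqp.ne_zero hw)

theorem smoothKernel_ne_zero (N : ℕ) {s w : ℂ} (hs : 0 < s.re) (hw : 0 ≤ w.re) :
    smoothKernel N s w ≠ 0 := by
  refine Finset.prod_ne_zero_iff.2 fun q hq => inv_ne_zero fun h => ?_
  have := norm_prime_cpow_lt_one (Nat.prime_of_mem_primesBelow hq) (z := star s + w)
    (by simp; linarith)
  rw [← sub_eq_zero.1 h] at this
  simp at this

/-- A lower bound for the kernel on `Re w ≥ 0`. -/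
theorem exists_le_norm_smoothKernel (N : ℕ) {s : ℂ} (hs : 0 < s.re) :
    ∃ c : ℝ, 0 < c ∧ ∀ w : ℂ, 0 ≤ w.re → c ≤ ‖smoothKernel N s w‖ := by
  -- The exponent `-1` gives a function of modulus `1/|K|`, which is bounded because it is uniformly
  -- approximable.
  obtain ⟨B, hB0, hB⟩ := (unifApprox_kernelPow N (-1) hs).bound
  refine ⟨(B + 1)⁻¹, by positivity, fun w hw => ?_⟩
  have h := hB w hw
  have hpos := norm_pos_iff.2 (smoothKernel_ne_zero N hs hw)
  rw [norm_kernelPow, Real.rpow_neg_one] at h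
  exact inv_le_of_inv_le₀ hpos (by linarith)

/-! ### Two-sided bounds for point evaluations -/

theorem tendsto_meanPow {p : ℝ} (hp : 1 ≤ p) (P : ℕ+ →₀ ℂ) :
    Tendsto (meanPow p P) atTop (𝓝 (meanNorm p P ^ p)) := by
  refine ((tendsto_meanNorm hp P).rpow_const (p := p) (Or.inr (by linarith))).congr' ?_
  filter_upwards [eventually_gt_atTop (0 : ℝ)] with T hT
  rw [← Real.rpow_mul (meanPow_nonneg P hT), one_div_mul_cancel (by linarith), Real.rpow_one]

theorem continuous_norm_eval_rpow {p : ℝ} (hp : 1 ≤ p) (P : ℕ+ →₀ ℂ) :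
    Continuous fun t : ℝ => ‖dirichletEval P (t * Complex.I)‖ ^ p :=
  (MeanAux.continuous_eval P).norm.rpow_const fun _ => Or.inr (by linarith)

theorem HasMean.norm_le {f : ℝ → ℂ} {m : ℂ} (hf : HasMean f m) {g : ℝ → ℝ} (hg : Continuous g)
    (hfg : ∀ t, ‖f t‖ ≤ g t) {M : ℝ}
    (hM : Tendsto (fun T : ℝ => T⁻¹ * ∫ t in (0 : ℝ)..T, g t) atTop (𝓝 M)) : ‖m‖ ≤ M := by
  refine le_of_tendsto_of_tendsto hf.tendsto.norm hM ?_
  filter_upwards [eventually_gt_atTop (0 : ℝ)] with T hT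
  rw [norm_mul, norm_inv, Complex.norm_real, Real.norm_of_nonneg hT.le]
  gcongr
  exact intervalIntegral.norm_integral_le_of_norm_le hT.le (ae_of_all _ fun t _ => hfg t)
    (hg.intervalIntegrable _ _)

theorem meanNorm_rpow_le {p : ℝ} (hp : 1 ≤ p) {P : ℕ+ →₀ ℂ} {g : ℝ → ℝ} (hg : Continuous g)
    (hPg : ∀ t : ℝ, ‖dirichletEval P (t * Complex.I)‖ ^ p ≤ g t) {M : ℝ}
    (hM : Tendsto (fun T : ℝ => T⁻¹ * ∫ t in (0 : ℝ)..T, g t) atTop (𝓝 M)) :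
    meanNorm p P ^ p ≤ M := by
  refine le_of_tendsto_of_tendsto (tendsto_meanPow hp P) hM ?_
  filter_upwards [eventually_gt_atTop (0 : ℝ)] with T hT
  unfold meanPow
  gcongr
  exact intervalIntegral.integral_mono hT.le
    ((continuous_norm_eval_rpow hp P).intervalIntegrable _ _) (hg.intervalIntegrable _ _) hPg

/-- Hölder's inequality in pointwise form: weighted arithmetic–geometric mean applied to quantities
normalized by `A` and `κ`. The right side is linear in `x ^ p` and `k ^ 2`, so it can be averaged
directly. -/
theorem mul_rpow_le_weighted {p x k A κ : ℝ} (hp : 1 ≤ p) (hx : 0 ≤ x) (hk : 0 ≤ k) (hA : 0 < A)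
    (hκ : 0 < κ) : x * k ^ (2 - 2 / p) ≤
      A ^ (1 / p) * κ ^ (1 - 1 / p) * (1 / p * (x ^ p / A) + (1 - 1 / p) * (k ^ 2 / κ)) := by
  have hp0 : 0 < p := by linarith
  have h1 : 0 ≤ 1 - 1 / p := by
    rw [sub_nonneg, div_le_one hp0]; exact hp
  have h := Real.geom_mean_le_arith_mean2_weighted (w₁ := 1 / p) (w₂ := 1 - 1 / p)
    (p₁ := x ^ p / A) (p₂ := k ^ 2 / κ) (by positivity) h1 (by positivity) (by positivity) (by ring)
  refine le_trans (le_of_eq ?_) (mul_le_mul_of_nonneg_left h (by positivity))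
  rw [Real.div_rpow (by positivity) hA.le, Real.div_rpow (by positivity) hκ.le,
    ← Real.rpow_mul hx, mul_one_div_cancel hp0.ne', Real.rpow_one, ← Real.rpow_natCast,
    ← Real.rpow_mul hk]
  have e : ((2 : ℕ) : ℝ) * (1 - 1 / p) = 2 - 2 / p := by push_cast; ring
  rw [e]
  have hA' : A ^ (1 / p) ≠ 0 := (Real.rpow_pos_of_pos hA _).ne'
  have hκ' : κ ^ (1 - 1 / p) ≠ 0 := (Real.rpow_pos_of_pos hκ _).ne'
  field_simp

/-- Apply the reproducing formula to `P K^{1 - 2/p}`: its value at `s` is the mean of a function of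
modulus `|P| |K|^{2 - 2/p}`, and Hölder bounds this by the means of `|P|^p` and `|K|²`. A positive
majorant `A` replaces the mean of `|P|^p` so that division is allowed. -/
theorem norm_dirichletEval_mul_rpow_le {p : ℝ} (hp : 1 ≤ p) {N : ℕ} {P : ℕ+ →₀ ℂ}
    (hP : dirichletEval P ∈ smoothAlg N) {s : ℂ} (hs : 0 < s.re) {A : ℝ} (hA0 : 0 < A)
    (hA : meanNorm p P ^ p ≤ A) :
    ‖dirichletEval P s‖ * partialZeta N (2 * s.re) ^ (1 - 2 / p) ≤
      A ^ (1 / p) * partialZeta N (2 * s.re) ^ (1 - 1 / p) := by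
  set κ := partialZeta N (2 * s.re) with hκ
  have hp0 : 0 < p := by linarith
  have hκ1 : 1 ≤ κ := one_le_partialZeta N (by linarith)
  have hκ0 : 0 < κ := by linarith
  have hre : ∀ t : ℝ, 0 ≤ ((t : ℂ) * Complex.I).re := fun t => by simp
  obtain ⟨BP, hBP⟩ := exists_bound_of_mem_smoothAlg hP
  set BK := ∑' m : N.smoothNumbers, ‖((m : ℕ) : ℂ) ^ (-star s)‖
  have hBP0 : 0 ≤ BP := (norm_nonneg _).trans (hBP 0 le_rfl)
  obtain ⟨hKc, hKm⟩ := tendsto_mean_norm_kernel N hs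
  have hPc := continuous_norm_eval_rpow hp P
  set X := A ^ (1 / p) * κ ^ (1 - 1 / p) with hX
  have hX0 : 0 ≤ X := by positivity
  have main : ∀ ε > 0, ‖dirichletEval P s‖ * κ ^ (1 - 2 / p) ≤
      X + ε * (BP * BK + ‖dirichletEval P s‖) := by
    intro ε hε
    -- The reproducing formula is available only for polynomials, so the kernel power is replaced by
    -- an approximant `F`.
    obtain ⟨F, hF, hFG⟩ := unifApprox_kernelPow N (1 - 2 / p) hs ε hε
    have hm := hasMean_mul_kernel (mul_mem hP hF) hs
    have hlim : Tendsto (fun T : ℝ => T⁻¹ * ∫ t in (0 : ℝ)..T,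
        (X / p / A * ‖dirichletEval P (t * Complex.I)‖ ^ p +
        X * (1 - 1 / p) / κ * ‖smoothKernel N s (t * Complex.I)‖ ^ 2 + ε * (BP * BK))) atTop
        (𝓝 (X / p / A * meanNorm p P ^ p + X * (1 - 1 / p) / κ * κ + ε * (BP * BK))) := by
      refine ((((tendsto_meanPow hp P).const_mul (X / p / A)).add
        (hKm.const_mul (X * (1 - 1 / p) / κ))).add
        (tendsto_const_nhds (x := ε * (BP * BK)))).congr' ?_
      filter_upwards [eventually_gt_atTop (0 : ℝ)] with T hT
      rw [intervalIntegral.integral_add (Continuous.intervalIntegrable (by fun_prop) _ _)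
        (Continuous.intervalIntegrable (by fun_prop) _ _),
        intervalIntegral.integral_add (Continuous.intervalIntegrable (by fun_prop) _ _)
        (Continuous.intervalIntegrable (by fun_prop) _ _),
        intervalIntegral.integral_const_mul, intervalIntegral.integral_const_mul,
        intervalIntegral.integral_const, meanPow, smul_eq_mul]
      generalize (∫ t in (0 : ℝ)..T, ‖dirichletEval P (t * Complex.I)‖ ^ p) = I₁
      generalize (∫ t in (0 : ℝ)..T, ‖smoothKernel N s (t * Complex.I)‖ ^ 2) = I₂
      field_simp
      ring
    have hle := hm.norm_le (by fun_prop) (fun t => ?_) hlim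
    -- The Hölder weights `1/p` and `1 - 1/p` add up to `1`.
    · have h1 : X / p / A * meanNorm p P ^ p + X * (1 - 1 / p) / κ * κ ≤ X := by
        calc _ ≤ X / p / A * A + X * (1 - 1 / p) / κ * κ := by gcongr
          _ = X := by field_simp; ring
      have h2 : κ ^ (1 - 2 / p) ≤ ‖F s‖ + ε := by
        have : ‖kernelPow N (1 - 2 / p) s s‖ = κ ^ (1 - 2 / p) := by
          rw [norm_kernelPow, smoothKernel_self, Complex.norm_real, Real.norm_of_nonneg hκ0.le]
        rw [← this]
        have h := hFG s hs.le
        have := norm_sub_norm_le (kernelPow N (1 - 2 / p) s s) (F s)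
        rw [norm_sub_rev] at this
        linarith
      have h3 : ‖(dirichletEval P * F) s‖ = ‖dirichletEval P s‖ * ‖F s‖ := by
        rw [Pi.mul_apply, norm_mul]
      rw [h3] at hle
      have := mul_le_mul_of_nonneg_left h2 (norm_nonneg (dirichletEval P s))
      linarith
    · set w := (t : ℂ) * Complex.I
      have hw : 0 ≤ w.re := hre t
      have hK0 := norm_pos_iff.2 (smoothKernel_ne_zero N hs hw)
      rw [Pi.mul_apply, norm_mul, norm_mul, norm_star]
      have hFb : ‖F w‖ ≤ ‖smoothKernel N s w‖ ^ (1 - 2 / p) + ε := by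
        rw [← norm_kernelPow]
        have := norm_sub_norm_le (F w) (kernelPow N (1 - 2 / p) s w)
        linarith [hFG w hw]
      have hy := mul_rpow_le_weighted hp (norm_nonneg (dirichletEval P w))
        (norm_nonneg (smoothKernel N s w)) hA0 hκ0
      have e : (2 : ℝ) - 2 / p = (1 - 2 / p) + 1 := by ring
      rw [e, Real.rpow_add hK0, Real.rpow_one, ← hX] at hy
      calc _ ≤ ‖dirichletEval P w‖ * (‖smoothKernel N s w‖ ^ (1 - 2 / p) + ε) *
            ‖smoothKernel N s w‖ := by gcongr
        _ = ‖dirichletEval P w‖ * (‖smoothKernel N s w‖ ^ (1 - 2 / p) * ‖smoothKernel N s w‖) +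
            ε * (‖dirichletEval P w‖ * ‖smoothKernel N s w‖) := by ring
        _ ≤ X * (1 / p * (‖dirichletEval P w‖ ^ p / A) +
            (1 - 1 / p) * (‖smoothKernel N s w‖ ^ 2 / κ)) + ε * (BP * BK) := by
            gcongr
            exacts [hBP w hw, norm_smoothKernel_le N hs hw]
        _ = _ := by ring
  have hlim : Tendsto (fun ε : ℝ => X + ε * (BP * BK + ‖dirichletEval P s‖)) (𝓝[>] 0)
      (𝓝 (X + 0 * (BP * BK + ‖dirichletEval P s‖))) :=
    (Continuous.tendsto (by fun_prop) _).mono_left nhdsWithin_le_nhds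
  rw [zero_mul, add_zero] at hlim
  exact ge_of_tendsto hlim (eventually_mem_nhdsWithin.mono fun ε hε => main ε hε)

/-- Point evaluation at `s` has norm at most `ζ(2 Re s)^{1/p}`. -/
theorem norm_dirichletEval_le_meanNorm {p : ℝ} (hp : 1 ≤ p) (P : ℕ+ →₀ ℂ) {s : ℂ}
    (hs : 1 / 2 < s.re) :
    ‖dirichletEval P s‖ ≤ realZeta (2 * s.re) ^ (1 / p) * meanNorm p P := by
  have hp0 : 0 < p := by linarith
  obtain ⟨N, hN⟩ := exists_mem_smoothAlg P
  have hP := hN N le_rfl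
  set κ := partialZeta N (2 * s.re) with hκ
  have hκ1 : 1 ≤ κ := one_le_partialZeta N (by linarith)
  have hκ0 : 0 < κ := by linarith
  have hM := meanNorm_nonneg hp P
  have h1 : ∀ A : ℝ, meanNorm p P ^ p < A → ‖dirichletEval P s‖ ≤ κ ^ (1 / p) * A ^ (1 / p) := by
    intro A hA
    have hA0 : 0 < A := lt_of_le_of_lt (by positivity) hA
    have h := norm_dirichletEval_mul_rpow_le hp hP (by linarith) hA0 hA.le
    have hpow : 0 < κ ^ (1 - 2 / p) := Real.rpow_pos_of_pos hκ0 _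
    have e : (1 : ℝ) - 1 / p = 1 / p + (1 - 2 / p) := by ring
    rw [← hκ, e, Real.rpow_add hκ0, ← mul_assoc] at h
    rw [mul_comm (κ ^ (1 / p))]
    exact le_of_mul_le_mul_right h hpow
  have h2 : ‖dirichletEval P s‖ ≤ κ ^ (1 / p) * (meanNorm p P ^ p) ^ (1 / p) := by
    have hc : Tendsto (fun A : ℝ => κ ^ (1 / p) * A ^ (1 / p)) (𝓝[>] (meanNorm p P ^ p))
        (𝓝 (κ ^ (1 / p) * (meanNorm p P ^ p) ^ (1 / p))) :=
      ((Real.continuousAt_rpow_const _ _ (Or.inr (by positivity))).const_mul _).tendsto.mono_left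
        nhdsWithin_le_nhds
    exact ge_of_tendsto hc (eventually_mem_nhdsWithin.mono fun A hA => h1 A hA)
  rw [← Real.rpow_mul hM, mul_one_div_cancel hp0.ne', Real.rpow_one] at h2
  refine h2.trans ?_
  gcongr
  exact partialZeta_le_realZeta N (by linarith)

/-- Point evaluation at `s` has norm at least a multiple of `ζ(2 Re s)^{1/p}`. -/
theorem exists_large_dirichletEval {p : ℝ} (hp : 1 ≤ p) {s : ℂ} (hs : 1 / 2 < s.re) :
    ∃ P : ℕ+ →₀ ℂ, meanNorm p P ≤ 1 ∧ realZeta (2 * s.re) ^ (1 / p) / 8 ≤ ‖dirichletEval P s‖ := by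
  have hp0 : 0 < p := by linarith
  have hs0 : 0 < s.re := by linarith
  have hζ : 1 ≤ realZeta (2 * s.re) := one_le_realZeta (by linarith)
  -- Truncation at `N` keeps more than half of the zeta value.
  obtain ⟨N, hN⟩ := ((tendsto_partialZeta (x := 2 * s.re) (by linarith)).eventually
    (lt_mem_nhds (show realZeta (2 * s.re) / 2 < realZeta (2 * s.re) by linarith))).exists
  set κ := partialZeta N (2 * s.re) with hκ
  have hκ1 : 1 ≤ κ := one_le_partialZeta N (by linarith)
  have hκ0 : 0 < κ := by linarith
  obtain ⟨c, hc0, hc⟩ := exists_le_norm_smoothKernel N hs0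
  -- The first tolerance, with `c` a lower bound of `|K|`, gives `|P| ≤ 2 |K|^{2/p}` on the axis,
  -- whose `p`th power has mean `2^p κ`. The second keeps at least half of the value `κ^{2/p}` at
  -- `s`.
  obtain ⟨F, hF, hFG⟩ := unifApprox_kernelPow N (2 / p) hs0 (min (c ^ (2 / p)) (κ ^ (2 / p) / 2))
    (by positivity)
  obtain ⟨P, rfl⟩ := exists_dirichletEval_eq hF
  obtain ⟨hKc, hKm⟩ := tendsto_mean_norm_kernel N hs0
  have hnorm : meanNorm p P ^ p ≤ 2 ^ p * κ := by
    refine meanNorm_rpow_le hp (g := fun t => 2 ^ p * ‖smoothKernel N s (t * Complex.I)‖ ^ 2)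
      (by fun_prop) (fun t => ?_) ((hKm.const_mul (2 ^ p)).congr fun T => ?_)
    · set w := (t : ℂ) * Complex.I
      have hw : 0 ≤ w.re := by simp [w]
      have h1 : ‖dirichletEval P w‖ ≤ 2 * ‖smoothKernel N s w‖ ^ (2 / p) := by
        have h := norm_sub_norm_le (dirichletEval P w) (kernelPow N (2 / p) s w)
        have h' := (hFG w hw).trans (min_le_left _ _)
        have h'' : c ^ (2 / p) ≤ ‖smoothKernel N s w‖ ^ (2 / p) := by
          gcongr; exact hc w hw
        rw [norm_kernelPow] at h
        linarith
      calc _ ≤ (2 * ‖smoothKernel N s w‖ ^ (2 / p)) ^ p := by gcongr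
        _ = 2 ^ p * ‖smoothKernel N s w‖ ^ 2 := by
          rw [Real.mul_rpow (by norm_num) (by positivity), ← Real.rpow_mul (norm_nonneg _),
            div_mul_cancel₀ _ hp0.ne', ← Real.rpow_natCast]
          norm_num
    · rw [intervalIntegral.integral_const_mul]
      ring
  have hnorm' : meanNorm p P ≤ 2 * κ ^ (1 / p) := by
    have h := Real.rpow_le_rpow (by have := meanNorm_nonneg hp P; positivity) hnorm
      (show 0 ≤ 1 / p by positivity)
    rwa [← Real.rpow_mul (meanNorm_nonneg hp P), mul_one_div_cancel hp0.ne', Real.rpow_one,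
      Real.mul_rpow (by positivity) hκ0.le, ← Real.rpow_mul (by norm_num),
      mul_one_div_cancel hp0.ne', Real.rpow_one] at h
  have hval : κ ^ (2 / p) / 2 ≤ ‖dirichletEval P s‖ := by
    have h := norm_sub_norm_le (kernelPow N (2 / p) s s) (dirichletEval P s)
    have h' := (hFG s hs0.le).trans (min_le_right _ _)
    rw [norm_sub_rev] at h'
    rw [norm_kernelPow, smoothKernel_self, Complex.norm_real, Real.norm_of_nonneg hκ0.le] at h
    linarith
  have hk : 0 < κ ^ (1 / p) := by positivity
  -- The `8` is a product of three losses of `2`: in the norm, in the value at `s`, and in passing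
  -- from `ζ` to `κ`.
  refine ⟨(((2 * κ ^ (1 / p))⁻¹ : ℝ) : ℂ) • P, ?_, ?_⟩
  · rw [meanNorm_smul hp, Complex.norm_real, Real.norm_of_nonneg (by positivity),
      inv_mul_le_iff₀ (by positivity), mul_one]
    exact hnorm'
  · rw [dirichletEval_smul, norm_mul, Complex.norm_real, Real.norm_of_nonneg (by positivity)]
    have e : κ ^ (2 / p) = κ ^ (1 / p) * κ ^ (1 / p) := by
      rw [← Real.rpow_add hκ0]; congr 1; ring
    rw [e] at hval
    have h2 : realZeta (2 * s.re) ^ (1 / p) ≤ 2 * κ ^ (1 / p) := by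
      calc _ ≤ (2 * κ) ^ (1 / p) := by gcongr; linarith
        _ = 2 ^ (1 / p) * κ ^ (1 / p) := Real.mul_rpow (by norm_num) hκ0.le
        _ ≤ 2 ^ (1 : ℝ) * κ ^ (1 / p) := by
          gcongr
          · norm_num
          · rw [div_le_one hp0]; exact hp
        _ = _ := by rw [Real.rpow_one]
    rw [le_inv_mul_iff₀ (by positivity)]
    nlinarith

/-! ### Gaussian averaging: from `ℋ^∞` to Dirichlet polynomials -/

theorem isOpen_halfPlane (θ : ℝ) : IsOpen (halfPlane θ) :=
  isOpen_lt continuous_const Complex.continuous_re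

/-- The Gaussian average of `h` along the vertical line through `s`, at scale `c`. -/
noncomputable def gaussAverage (h : ℂ → ℂ) (c : ℝ) (s : ℂ) : ℂ :=
  ∫ x : ℝ, h (s + c * x * Complex.I) ∂(ProbabilityTheory.gaussianReal 0 1)

theorem add_mul_I_mem {s : ℂ} (hs : s ∈ halfPlane 0) (c x : ℝ) :
    s + c * x * Complex.I ∈ halfPlane 0 := by
  simpa [halfPlane] using hs

/-- Differentiation under the integral: Cauchy's estimate on discs of radius `Re s / 4` bounds `h'`
uniformly on `Re z > Re s / 2`. -/
theorem differentiableOn_gaussAverage {h : ℂ → ℂ} (hd : DifferentiableOn ℂ h (halfPlane 0)) {B : ℝ}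
    (hB : ∀ s ∈ halfPlane 0, ‖h s‖ ≤ B) (c : ℝ) :
    DifferentiableOn ℂ (gaussAverage h c) (halfPlane 0) := by
  intro s hs
  have hs0 : 0 < s.re := hs
  have hcont : ∀ {g : ℂ → ℂ}, ContinuousOn g (halfPlane 0) → ∀ z ∈ halfPlane 0,
      Continuous fun x : ℝ => g (z + c * x * Complex.I) := fun hg z hz =>
    hg.comp_continuous (by fun_prop) fun x => add_mul_I_mem hz c x
  have hd' : ContinuousOn (deriv h) (halfPlane 0) :=
    (hd.deriv (isOpen_halfPlane 0)).continuousOn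
  refine (hasDerivAt_integral_of_dominated_loc_of_deriv_le
    (F := fun z (x : ℝ) => h (z + c * x * Complex.I))
    (F' := fun z (x : ℝ) => deriv h (z + c * x * Complex.I))
    (s := halfPlane (s.re / 2)) (bound := fun _ => B / (s.re / 4))
    ((isOpen_halfPlane _).mem_nhds (show s.re / 2 < s.re by linarith)) ?_ ?_ ?_ ?_ ?_
    ?_).2.differentiableAt.differentiableWithinAt
  · filter_upwards [(isOpen_halfPlane 0).mem_nhds hs] with z hz
    exact (hcont hd.continuousOn z hz).aestronglyMeasurable
  · exact Integrable.of_bound (hcont hd.continuousOn s hs).aestronglyMeasurable B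
      (ae_of_all _ fun x => hB _ (add_mul_I_mem hs c x))
  · exact (hcont hd' s hs).aestronglyMeasurable
  · refine ae_of_all _ fun x z hz => ?_
    have hz' : s.re / 2 < z.re := hz
    have hball : Metric.closedBall (z + c * x * Complex.I) (s.re / 4) ⊆ halfPlane 0 := by
      intro w hw
      rw [mem_closedBall_iff_norm] at hw
      have := (abs_le.1 ((Complex.abs_re_le_norm _).trans hw)).1
      simp at this
      simp only [halfPlane, mem_ofPred_eq]
      linarith
    refine Complex.norm_deriv_le_of_forall_mem_sphere_norm_le (by linarith) ?_ ?_
    · refine DifferentiableOn.diffContOnCl (hd.mono ?_)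
      rw [closure_ball _ (by linarith)]
      exact hball
    · exact fun w hw => hB w (hball (Metric.sphere_subset_closedBall hw))
  · exact integrable_const _
  · refine ae_of_all _ fun x z hz => ?_
    have hz' : s.re / 2 < z.re := hz
    have hz0 : z ∈ halfPlane 0 := by simp only [halfPlane, mem_ofPred_eq]; linarith
    have h1 := (hd.differentiableAt
      ((isOpen_halfPlane 0).mem_nhds (add_mul_I_mem hz0 c x))).hasDerivAt
    simpa using h1.comp_add_const z (c * x * Complex.I)

theorem norm_gaussAverage_le {h : ℂ → ℂ} {B : ℝ} (hB : ∀ s ∈ halfPlane 0, ‖h s‖ ≤ B) (c : ℝ)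
    {s : ℂ} (hs : s ∈ halfPlane 0) : ‖gaussAverage h c s‖ ≤ B := by
  refine (norm_integral_le_of_norm_le_const (C := B)
    (ae_of_all _ fun x => hB _ (add_mul_I_mem hs c x))).trans ?_
  simp

theorem tendsto_gaussAverage {h : ℂ → ℂ} (hd : ContinuousOn h (halfPlane 0)) {B : ℝ}
    (hB : ∀ s ∈ halfPlane 0, ‖h s‖ ≤ B) {s : ℂ} (hs : s ∈ halfPlane 0) :
    Tendsto (fun c => gaussAverage h c s) (𝓝 0) (𝓝 (h s)) := by
  have e : h s = ∫ x : ℝ, h (s + (0 : ℝ) * x * Complex.I)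
      ∂(ProbabilityTheory.gaussianReal 0 1) := by simp
  rw [e]
  refine tendsto_integral_filter_of_dominated_convergence (fun _ => B) ?_ ?_ (integrable_const _) ?_
  · exact Eventually.of_forall fun c => (hd.comp_continuous (by fun_prop)
      fun x => add_mul_I_mem hs c x).aestronglyMeasurable
  · exact Eventually.of_forall fun c => ae_of_all _ fun x => hB _ (add_mul_I_mem hs c x)
  · refine ae_of_all _ fun x => ?_
    exact Continuous.tendsto (hd.comp_continuous (f := fun c : ℝ => s + c * x * Complex.I)
      (by fun_prop) fun c => add_mul_I_mem hs c x) 0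

/-- The average of `n^{-icx}` is the characteristic function of the standard Gaussian at `-c log n`,
so averaging multiplies the `n`th coefficient by a factor decaying faster than any power of `n` when
`c ≠ 0`. -/
theorem gaussAverage_cpow {n : ℕ} (hn : n ≠ 0) (c : ℝ) (s : ℂ) :
    gaussAverage (fun s => (n : ℂ) ^ (-s)) c s =
      (Real.exp (-(c * Real.log n) ^ 2 / 2) : ℂ) * (n : ℂ) ^ (-s) := by
  have h := ProbabilityTheory.charFun_gaussianReal (μ := 0) (v := 1) (-(c * Real.log n))
  rw [charFun_apply_real] at h
  have e : ∀ x : ℝ, (n : ℂ) ^ (-(s + c * x * Complex.I)) =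
      Complex.exp ((-(c * Real.log n) : ℝ) * x * Complex.I) * (n : ℂ) ^ (-s) := by
    intro x
    rw [natCast_cpow_add_neg hn, mul_comm, natCast_cpow_neg_eq_exp hn (c * x * Complex.I)]
    congr 2
    push_cast; ring
  simp only [gaussAverage, e]
  rw [integral_mul_const, h]
  congr 1
  push_cast
  congr 1
  simp [neg_div]

/-- The coefficients of a Dirichlet series, damped by the Gaussian, are absolutely summable. -/
theorem summable_damped {b : ℕ+ → ℂ} {σ : ℝ}
    (hb : Summable fun n : ℕ+ => ‖b n‖ * (n : ℝ) ^ (-σ)) {c : ℝ} (hc : c ≠ 0) :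
    Summable fun n : ℕ+ => ‖b n‖ * Real.exp (-(c * Real.log n) ^ 2 / 2) := by
  refine Summable.of_nonneg_of_le (fun n => by positivity) (fun n => ?_)
    (hb.mul_left (Real.exp (σ ^ 2 / (2 * c ^ 2))))
  have hn : (0 : ℝ) < (n : ℕ) := by exact_mod_cast n.pos
  rw [mul_left_comm, Real.rpow_def_of_pos hn, ← Real.exp_add]
  gcongr
  -- Completing the square in `log n` yields `exp(-(c log n)²/2) ≤ exp(σ²/(2c²)) n^{-σ}`.
  have : 0 ≤ (c * Real.log n - σ / c) ^ 2 := sq_nonneg _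
  have e : (c * Real.log n - σ / c) ^ 2 = (c * Real.log n) ^ 2 - 2 * Real.log n * σ
      + σ ^ 2 / c ^ 2 := by field_simp; ring
  rw [e] at this
  have e2 : σ ^ 2 / (2 * c ^ 2) = σ ^ 2 / c ^ 2 / 2 := by field_simp
  rw [e2]
  linarith

/-- Far to the right the series may be averaged term by term. The damped series converges absolutely
on all of `Re s > 0`, where both sides are analytic, so the identity theorem propagates the
equality. -/
theorem gaussAverage_eq_tsum {h : ℂ → ℂ} (hd : DifferentiableOn ℂ h (halfPlane 0)) {B : ℝ}
    (hB : ∀ s ∈ halfPlane 0, ‖h s‖ ≤ B) {b : ℕ+ → ℂ} (hb : HasDirichletSeries h b) {c : ℝ}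
    (hc : c ≠ 0) :
    (Summable fun n : ℕ+ => ‖b n‖ * Real.exp (-(c * Real.log n) ^ 2 / 2)) ∧
    ∀ s ∈ halfPlane 0, gaussAverage h c s = ∑' n : ℕ+,
      b n * ((Real.exp (-(c * Real.log n) ^ 2 / 2) : ℂ) * (n : ℂ) ^ (-s)) := by
  obtain ⟨σ, hσ⟩ := hb
  set τ := max σ 0 + 1 with hτ
  have hτσ : σ < τ := by have := le_max_left σ 0; linarith
  have hτ0 : 0 < τ := by have := le_max_right σ 0; linarith
  have hterm : ∀ s : ℂ, ∀ n : ℕ+, ‖b n * (n : ℂ) ^ (-s)‖ = ‖b n‖ * (n : ℝ) ^ (-s.re) :=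
    fun s n => by rw [norm_mul, norm_natCast_cpow_neg n.ne_zero]
  have habs : ∀ s : ℂ, τ ≤ s.re → Summable fun n : ℕ+ => ‖b n‖ * (n : ℝ) ^ (-s.re) := by
    intro s hs
    -- Unconditional convergence of a series of complex numbers is absolute.
    have := (hσ s (lt_of_lt_of_le hτσ hs)).summable.norm
    simpa only [hterm] using this
  have hsum : Summable fun n : ℕ+ => ‖b n‖ * Real.exp (-(c * Real.log n) ^ 2 / 2) := by
    refine summable_damped (σ := τ) ?_ hc
    simpa using habs τ (by simp)
  have hnorm : ∀ (n : ℕ+) (s : ℂ), 0 ≤ s.re →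
      ‖b n * ((Real.exp (-(c * Real.log n) ^ 2 / 2) : ℂ) * (n : ℂ) ^ (-s))‖ ≤
      ‖b n‖ * Real.exp (-(c * Real.log n) ^ 2 / 2) := by
    intro n s hs
    rw [norm_mul, norm_mul, Complex.norm_real,
      Real.norm_of_nonneg (Real.exp_pos _).le]
    gcongr
    exact mul_le_of_le_one_right (Real.exp_pos _).le (norm_natCast_cpow_neg_le_one n.ne_zero hs)
  refine ⟨hsum, ?_⟩
  have hA1 := (differentiableOn_gaussAverage hd hB c).analyticOnNhd (isOpen_halfPlane 0)
  have hA2 := (Complex.differentiableOn_tsum_of_summable_norm (U := halfPlane 0) hsum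
    (F := fun (n : ℕ+) s => b n * ((Real.exp (-(c * Real.log n) ^ 2 / 2) : ℂ) * (n : ℂ) ^ (-s)))
    (fun n => by
      have hn : (n : ℂ) ≠ 0 := by exact_mod_cast n.ne_zero
      exact fun s _ => (DifferentiableAt.const_mul (DifferentiableAt.const_mul
        (DifferentiableAt.const_cpow (by fun_prop) (Or.inl hn)) _) _).differentiableWithinAt)
    (isOpen_halfPlane 0) (fun n s hs => hnorm n s (le_of_lt hs))).analyticOnNhd (isOpen_halfPlane 0)
  have hpre : IsPreconnected (halfPlane 0) := (convex_halfSpace_re_gt 0).isPreconnected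
  refine hA1.eqOn_of_preconnected_of_eventuallyEq hA2 hpre (z₀ := (τ + 1 : ℝ))
    (by simp only [halfPlane, mem_ofPred_eq, Complex.ofReal_re]; linarith) ?_
  filter_upwards [(isOpen_halfPlane τ).mem_nhds
    (show ((τ + 1 : ℝ) : ℂ) ∈ halfPlane τ by simp [halfPlane])] with s hs
  have hs' : τ < s.re := hs
  have hint := hasSum_integral_of_summable_integral_norm
    (μ := ProbabilityTheory.gaussianReal 0 1)
    (F := fun (n : ℕ+) (x : ℝ) => b n * (n : ℂ) ^ (-(s + c * x * Complex.I)))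
    (fun n => by
      refine Integrable.of_bound (C := ‖b n‖ * (n : ℝ) ^ (-s.re))
        (Continuous.aestronglyMeasurable ?_) (ae_of_all _ fun x => ?_)
      · have hn : (n : ℂ) ≠ 0 := by exact_mod_cast n.ne_zero
        exact continuous_const.mul (Continuous.const_cpow (by fun_prop) (Or.inl hn))
      · rw [hterm]; simp)
    (by
      have : ∀ (n : ℕ+) (x : ℝ), ‖b n * (n : ℂ) ^ (-(s + c * x * Complex.I))‖ =
          ‖b n‖ * (n : ℝ) ^ (-s.re) := fun n x => by rw [hterm]; simp
      simp only [this]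
      simpa using habs s hs'.le)
  have e1 : gaussAverage h c s = ∫ x : ℝ, ∑' n : ℕ+, b n * (n : ℂ) ^ (-(s + c * x * Complex.I))
      ∂(ProbabilityTheory.gaussianReal 0 1) := by
    unfold gaussAverage
    congr 1
    ext x
    refine ((hσ _ ?_).tsum_eq).symm
    simp only [halfPlane, mem_ofPred_eq]
    simp
    linarith
  rw [e1, ← hint.tsum_eq]
  refine tsum_congr fun n => ?_
  rw [integral_const_mul, ← gaussAverage_cpow n.ne_zero]
  rfl

/-- Functions in `ℋ^∞` are approximated on finite sets by Dirichlet polynomials with almost the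
same bound. -/
theorem IsHInfty.exists_dirichletEval {h : ℂ → ℂ} (hh : IsHInfty h) {B : ℝ}
    (hB : ∀ s ∈ halfPlane 0, ‖h s‖ ≤ B) {ι : Type*} [Finite ι] {S : ι → ℂ}
    (hS : ∀ j, S j ∈ halfPlane 0) {ε : ℝ} (hε : 0 < ε) :
    ∃ Q : ℕ+ →₀ ℂ, (∀ t : ℝ, ‖dirichletEval Q (t * Complex.I)‖ ≤ B + ε) ∧
      ∀ j, ‖dirichletEval Q (S j) - h (S j)‖ ≤ ε := by
  obtain ⟨b, hb⟩ := hh.series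
  have hd := hh.differentiableOn
  have hev : ∀ᶠ c in 𝓝 (0 : ℝ), ∀ j, ‖gaussAverage h c (S j) - h (S j)‖ < ε / 2 := by
    rw [eventually_all]
    intro j
    have := Metric.tendsto_nhds.1 (tendsto_gaussAverage hd.continuousOn hB (hS j)) (ε / 2)
      (by positivity)
    simpa only [dist_eq_norm] using this
  obtain ⟨c, hc, hc0⟩ := ((hev.filter_mono nhdsWithin_le_nhds).and
    (self_mem_nhdsWithin (s := Ioi (0 : ℝ)))).exists
  have hc0 : c ≠ 0 := ne_of_gt hc0
  obtain ⟨hsum, heq⟩ := gaussAverage_eq_tsum hd hB hb hc0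
  set d : ℕ+ → ℂ := fun n => b n * (Real.exp (-(c * Real.log n) ^ 2 / 2) : ℂ) with hdd
  have hdn : ∀ n, ‖d n‖ = ‖b n‖ * Real.exp (-(c * Real.log n) ^ 2 / 2) := fun n => by
    rw [hdd, norm_mul, Complex.norm_real,
      Real.norm_of_nonneg (Real.exp_pos _).le]
  have hds : Summable fun n => ‖d n‖ := by simpa only [hdn] using hsum
  obtain ⟨s, hs⟩ := summable_iff_vanishing_norm.1 hds (ε / 2) (by positivity)
  set Q : ℕ+ →₀ ℂ := Finsupp.onFinset s (fun n => if n ∈ s then d n else 0)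
    (fun n hn => by by_contra h; simp [h] at hn) with hQ
  have hQe : ∀ w, dirichletEval Q w = ∑ n ∈ s, d n * (n : ℂ) ^ (-w) := by
    intro w
    rw [dirichletEval, hQ, Finsupp.onFinset_sum _ (by simp)]
    exact Finset.sum_congr rfl fun n hn => by rw [if_pos hn]
  have hterm : ∀ (w : ℂ), 0 ≤ w.re → ∀ n : ℕ+, ‖d n * (n : ℂ) ^ (-w)‖ ≤ ‖d n‖ := by
    intro w hw n
    rw [norm_mul]
    exact mul_le_of_le_one_right (norm_nonneg _) (norm_natCast_cpow_neg_le_one n.ne_zero hw)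
  have hclose : ∀ w ∈ halfPlane 0, ‖dirichletEval Q w - gaussAverage h c w‖ ≤ ε / 2 := by
    intro w hw
    have hw0 : 0 ≤ w.re := le_of_lt hw
    have hsw : Summable fun n : ℕ+ => d n * (n : ℂ) ^ (-w) :=
      Summable.of_norm_bounded hds (hterm w hw0)
    have e : gaussAverage h c w = ∑' n : ℕ+, d n * (n : ℂ) ^ (-w) := by
      rw [heq w hw]
      exact tsum_congr fun n => by rw [hdd]; ring
    rw [hQe, e]
    refine le_of_tendsto ((tendsto_const_nhds.sub hsw.hasSum).norm)
      ((Filter.eventually_ge_atTop s).mono fun u hu => ?_)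
    rw [← Finset.sum_sdiff hu, sub_add_cancel_right, norm_neg]
    refine (norm_sum_le _ _).trans ((Finset.sum_le_sum fun n _ => hterm w hw0 n).trans ?_)
    have := hs (u \ s) Finset.sdiff_disjoint
    rw [Real.norm_of_nonneg (Finset.sum_nonneg fun _ _ => norm_nonneg _)] at this
    exact this.le
  refine ⟨Q, fun t => ?_, fun j => ?_⟩
  -- Boundary values of `h` itself are never used: the bound holds for `Q` on `Re w > 0` and passes
  -- to the axis because `Q` is a polynomial.
  · have hcont : Continuous fun x : ℝ => dirichletEval Q (x + t * Complex.I) := by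
      simp only [hQe]
      refine continuous_finsetSum _ fun n _ => continuous_const.mul ?_
      have hn : (n : ℂ) ≠ 0 := by exact_mod_cast n.ne_zero
      exact Continuous.const_cpow (by fun_prop) (Or.inl hn)
    have hl : Tendsto (fun x : ℝ => ‖dirichletEval Q (x + t * Complex.I)‖) (𝓝[>] 0)
        (𝓝 ‖dirichletEval Q ((0 : ℝ) + t * Complex.I)‖) :=
      (hcont.norm.tendsto 0).mono_left nhdsWithin_le_nhds
    rw [Complex.ofReal_zero, zero_add] at hl
    refine le_of_tendsto hl (eventually_mem_nhdsWithin.mono fun x hx => ?_)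
    have hm : (x : ℂ) + t * Complex.I ∈ halfPlane 0 := by simpa [halfPlane] using hx
    have h1 := hclose _ hm
    have h2 := norm_gaussAverage_le hB c hm
    have h3 := norm_sub_norm_le (dirichletEval Q (x + t * Complex.I))
      (gaussAverage h c (x + t * Complex.I))
    linarith
  · have h1 := hclose _ (hS j)
    have h2 := hc j
    have h3 := norm_sub_le_norm_sub_add_norm_sub (dirichletEval Q (S j))
      (gaussAverage h c (S j)) (h (S j))
    linarith

/-! ### Point evaluations and Carleson inequalities on the completion -/

section Evaluation

variable {p : ℝ} [hp : Fact (1 ≤ p)]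

theorem uniformContinuous_dirichletEval {s : ℂ} (hs : s ∈ halfPlane (1 / 2)) :
    UniformContinuous fun P : DirichletPolynomial p => dirichletEval P s := by
  let L : DirichletPolynomial p →ₗ[ℂ] ℂ :=
    { toFun := fun P => dirichletEval P s
      map_add' := fun P Q => dirichletEval_add P Q s
      map_smul' := fun a P => dirichletEval_smul a P s }
  exact (L.mkContinuous (realZeta (2 * s.re) ^ (1 / p)) fun P =>
    norm_dirichletEval_le_meanNorm hp.out P hs).uniformContinuous

theorem pointEval_coe {s : ℂ} (hs : s ∈ halfPlane (1 / 2)) (P : DirichletPolynomial p) :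
    pointEval s (P : HardyDirichlet p) = dirichletEval P s :=
  UniformSpace.Completion.extension_coe (uniformContinuous_dirichletEval hs) P

theorem norm_pointEval_le {s : ℂ} (hs : s ∈ halfPlane (1 / 2)) (f : HardyDirichlet p) :
    ‖pointEval s f‖ ≤ realZeta (2 * s.re) ^ (1 / p) * ‖f‖ := by
  induction f using UniformSpace.Completion.induction_on with
  | hp =>
    exact isClosed_le (UniformSpace.Completion.continuous_extension.norm) (by fun_prop)
  | ih P =>
    rw [pointEval_coe hs, UniformSpace.Completion.norm_coe]
    exact norm_dirichletEval_le_meanNorm hp.out P hs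

theorem pointEvalNorm_le {s : ℂ} (hs : s ∈ halfPlane (1 / 2)) :
    pointEvalNorm p s ≤ ENNReal.ofReal (realZeta (2 * s.re) ^ (1 / p)) := by
  have hs' : 1 / 2 < s.re := hs
  have hζ := one_le_realZeta (x := 2 * s.re) (by linarith)
  refine iSup₂_le fun f hf => ?_
  rw [← ofReal_norm]
  refine ENNReal.ofReal_le_ofReal ((norm_pointEval_le hs f).trans ?_)
  exact mul_le_of_le_one_right (by positivity) hf

/-- A Carleson inequality for `μ_S` gives a weighted `ℓ^p` bound for the values on `S`. -/
theorem sum_pointEval_le_of_carleson {n : ℕ} {S : Fin n → ℂ} (hS : ∀ j, S j ∈ halfPlane (1 / 2))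
    {C : ℝ} (hC0 : 0 ≤ C) (hC : ∀ f : HardyDirichlet p,
      ∫⁻ s in halfPlane (1 / 2), ‖pointEval s f‖ₑ ^ p ∂(pointMeasure p S) ≤
        ENNReal.ofReal C * ‖f‖ₑ ^ p) (f : HardyDirichlet p) :
    ∑ j, (realZeta (2 * (S j).re))⁻¹ * ‖pointEval (S j) f‖ ^ p ≤ C * ‖f‖ ^ p := by
  have hp0 : 0 < p := by linarith [hp.out]
  have hm : MeasurableSet (halfPlane (1 / 2)) := (isOpen_halfPlane _).measurableSet
  have hζ : ∀ j, 1 ≤ realZeta (2 * (S j).re) := fun j =>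
    one_le_realZeta (by have : 1 / 2 < (S j).re := hS j; linarith)
  have h := hC f
  rw [pointMeasure, Measure.restrict_sum _ hm, lintegral_sum_measure, tsum_fintype] at h
  -- The upper bound on point evaluations gives `‖δ_s‖^{-p} ≥ ζ(2 Re s)^{-1}`, so each atom carries
  -- at least the mass used here.
  have e : ∀ j, ENNReal.ofReal ((realZeta (2 * (S j).re))⁻¹ * ‖pointEval (S j) f‖ ^ p) ≤
      ∫⁻ s, ‖pointEval s f‖ₑ ^ p ∂(((pointEvalNorm p (S j) ^ p)⁻¹ •
        Measure.dirac (S j)).restrict (halfPlane (1 / 2))) := by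
    intro j
    classical
    rw [Measure.restrict_smul, restrict_dirac' hm, if_pos (hS j), lintegral_smul_measure,
      lintegral_dirac, smul_eq_mul, ENNReal.ofReal_mul (by have := hζ j; positivity),
      ENNReal.ofReal_inv_of_pos (by have := hζ j; positivity),
      ← ENNReal.ofReal_rpow_of_nonneg (norm_nonneg _) hp0.le, ofReal_norm]
    gcongr
    refine (ENNReal.rpow_le_rpow (pointEvalNorm_le (hS j)) hp0.le).trans (le_of_eq ?_)
    have := hζ j
    rw [ENNReal.ofReal_rpow_of_nonneg (by positivity) hp0.le, ← Real.rpow_mul (by positivity),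
      one_div_mul_cancel hp0.ne', Real.rpow_one]
  have h2 := (Finset.sum_le_sum fun j (_ : j ∈ Finset.univ) => e j).trans h
  rw [← ENNReal.ofReal_sum_of_nonneg (fun j _ => by have := hζ j; positivity), ← ofReal_norm,
    ENNReal.ofReal_rpow_of_nonneg (norm_nonneg _) hp0.le, ← ENNReal.ofReal_mul hC0] at h2
  exact (ENNReal.ofReal_le_ofReal_iff (by positivity)).1 h2

end Evaluation

/-! ### Finite-dimensional inequalities and the rank argument -/

/-- The discrete Fourier matrix has orthogonal columns. -/
theorem exists_orthogonal_unimodular {n : ℕ} (hn : 1 ≤ n) : ∃ U : Fin n → Fin n → ℂ,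
    (∀ k j, ‖U k j‖ = 1) ∧
      ∀ j l, ∑ k, star (U k j) * U k l = if j = l then (n : ℂ) else 0 := by
  obtain ⟨ω, hω⟩ : ∃ ω : ℂ, IsPrimitiveRoot ω n := ⟨_, Complex.isPrimitiveRoot_exp n (by omega)⟩
  have hn1 : ‖ω‖ = 1 := hω.norm'_eq_one (by omega)
  have hω0 : ω ≠ 0 := by rw [← norm_pos_iff, hn1]; exact one_pos
  refine ⟨fun k j => ω ^ ((k : ℕ) * (j : ℕ)), fun k j => by rw [norm_pow, hn1, one_pow],
    fun j l => ?_⟩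
  have hstar : star ω = ω⁻¹ := by
    rw [Complex.inv_eq_conj hn1]; rfl
  -- The inner product of columns `j` and `l` is a geometric sum whose ratio `z` is an `n`th root of
  -- unity, equal to `1` only if `j = l`.
  set z := ω⁻¹ ^ (j : ℕ) * ω ^ (l : ℕ) with hz
  have e : ∀ k : Fin n, star (ω ^ ((k : ℕ) * (j : ℕ))) * ω ^ ((k : ℕ) * (l : ℕ)) = z ^ (k : ℕ) := by
    intro k
    rw [star_pow, hstar, hz, mul_pow, ← pow_mul, ← pow_mul, mul_comm (j : ℕ), mul_comm (l : ℕ)]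
  simp only [e]
  rw [Fin.sum_univ_eq_sum_range (fun k => z ^ k)]
  split_ifs with h
  · subst h
    have : z = 1 := by rw [hz, ← mul_pow, inv_mul_cancel₀ hω0, one_pow]
    simp [this]
  · have hzn : z ^ n = 1 := by
      rw [hz, mul_pow, ← pow_mul, ← pow_mul, mul_comm (j : ℕ), mul_comm (l : ℕ), pow_mul, pow_mul,
        inv_pow, hω.pow_eq_one]
      simp
    have hz1 : z ≠ 1 := by
      intro h1
      rw [hz, inv_pow, inv_mul_eq_one₀ (pow_ne_zero _ hω0)] at h1
      exact h (Fin.ext (hω.pow_inj j.2 l.2 h1))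
    have := mul_neg_geom_sum z n
    rw [hzn, sub_self] at this
    exact (mul_eq_zero.1 this).resolve_left (sub_ne_zero.2 hz1.symm)

/-- Bessel's inequality for the columns scaled by `n^{-1/2}`; the remaining factor `1/n` cancels `∑
|g_k|² ≤ n M²`, so no power of `n` is lost. -/
theorem sum_norm_sq_le_of_orthogonal {n : ℕ} (hn : 1 ≤ n) {U : Fin n → Fin n → ℂ}
    (hU : ∀ j l, ∑ k, star (U k j) * U k l = if j = l then (n : ℂ) else 0) {g : Fin n → ℂ} {M : ℝ}
    (hg : ∀ k, ‖g k‖ ≤ M) :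
    ∑ j, ‖(n : ℂ)⁻¹ * ∑ k, star (U k j) * g k‖ ^ 2 ≤ M ^ 2 := by
  have hn0 : (0 : ℝ) < n := by exact_mod_cast hn
  have hnc : (n : ℂ) ≠ 0 := by exact_mod_cast hn0.ne'
  set r : ℂ := (((Real.sqrt n)⁻¹ : ℝ) : ℂ) with hr
  have hrr : r * r = (n : ℂ)⁻¹ := by
    rw [hr, ← Complex.ofReal_mul, ← mul_inv, Real.mul_self_sqrt hn0.le]; push_cast; rfl
  have hrs : star r = r := Complex.conj_ofReal _
  have hrn : ‖r‖ ^ 2 = (n : ℝ)⁻¹ := by rw [sq, ← norm_mul, hrr]; simp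
  have hv : Orthonormal ℂ fun j : Fin n => WithLp.toLp 2 fun k => r * U k j := by
    rw [orthonormal_iff_ite]
    intro j l
    rw [PiLp.inner_apply]
    have : ∀ k, inner ℂ (r * U k j) (r * U k l) = (n : ℂ)⁻¹ * (star (U k j) * U k l) := fun k => by
      rw [RCLike.inner_apply, map_mul, ← hrr, ← Complex.star_def, hrs]
      ring
    simp only [this]
    rw [← Finset.mul_sum, hU]
    split_ifs <;> simp [hnc]
  have h := hv.sum_inner_products_le (WithLp.toLp 2 g) (s := Finset.univ)
  have e : ∀ j : Fin n, ‖(n : ℂ)⁻¹ * ∑ k, star (U k j) * g k‖ ^ 2 = (n : ℝ)⁻¹ *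
      ‖inner ℂ (WithLp.toLp 2 fun k => r * U k j) (WithLp.toLp 2 g)‖ ^ 2 := by
    intro j
    rw [PiLp.inner_apply, ← hrn, ← mul_pow, ← norm_mul, ← hrr, mul_assoc, Finset.mul_sum]
    congr 4
    ext k
    rw [RCLike.inner_apply, map_mul, ← Complex.star_def, hrs]
    ring
  simp only [e]
  rw [← Finset.mul_sum, inv_mul_le_iff₀ hn0]
  refine h.trans ?_
  rw [EuclideanSpace.norm_sq_eq]
  calc _ ≤ ∑ _k : Fin n, M ^ 2 := Finset.sum_le_sum fun k _ => by
        gcongr; exact hg k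
    _ = n * M ^ 2 := by simp

theorem rpow_sum_le_sum_rpow {ι : Type*} (s : Finset ι) {f : ι → ℝ} (hf : ∀ i, 0 ≤ f i) {r : ℝ}
    (hr0 : 0 < r) (hr : r ≤ 1) : (∑ i ∈ s, f i) ^ r ≤ ∑ i ∈ s, f i ^ r := by
  classical
  induction s using Finset.induction_on with
  | empty => simp [hr0.ne']
  | insert i s hi ih =>
    rw [Finset.sum_insert hi, Finset.sum_insert hi]
    exact (Real.rpow_add_le_add_rpow (hf i) (Finset.sum_nonneg fun i _ => hf i) hr0.le hr).trans
      (by gcongr)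

/-- The comparison of the `ℓ²` and `ℓ^p` norms in dimension `n`. -/
theorem sum_sq_rpow_le {n : ℕ} {p : ℝ} (hp : 1 ≤ p) {x : Fin n → ℝ}
    (hx : ∀ j, 0 ≤ x j) :
    (∑ j, x j ^ 2) ^ (p / 2) ≤ ((n : ℝ) ^ (1 / min 2 p - 1 / p)) ^ p * ∑ j, x j ^ p := by
  have hp0 : 0 < p := by linarith
  have e : ∀ j, (x j ^ 2) ^ (p / 2) = x j ^ p := fun j => by
    rw [← Real.rpow_natCast, ← Real.rpow_mul (hx j)]
    congr 1; push_cast; ring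
  -- For `p ≤ 2`, subadditivity of `x ↦ x^{p/2}` gives the constant `1`; for `p ≥ 2`, the power mean
  -- inequality gives `n^{p/2 - 1}`.
  rcases le_total p 2 with h | h
  · rw [min_eq_right h, sub_self, Real.rpow_zero, Real.one_rpow, one_mul]
    refine (rpow_sum_le_sum_rpow _ (fun j => sq_nonneg _) (by positivity) (by linarith)).trans ?_
    simp only [e, le_refl]
  · have h1 := Real.rpow_sum_le_const_mul_sum_rpow_of_nonneg (Finset.univ : Finset (Fin n))
      (f := fun j => x j ^ 2) (p := p / 2) (by linarith) (fun j _ => sq_nonneg _)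
    simp only [e, Finset.card_univ, Fintype.card_fin] at h1
    rw [min_eq_left h, ← Real.rpow_mul (Nat.cast_nonneg n)]
    have e2 : (1 / 2 - 1 / p) * p = p / 2 - 1 := by field_simp
    rw [e2]
    exact h1

/-- Cauchy–Schwarz followed by the comparison of `ℓ²` with `ℓ^p`. This is the only source of the
power of `n` in the theorem. -/
theorem norm_sum_mul_rpow_le {n : ℕ} {p : ℝ} (hp : 1 ≤ p) {h z : Fin n → ℂ} {M : ℝ}
    (hM : 0 ≤ M) (hh : ∑ j, ‖h j‖ ^ 2 ≤ M ^ 2) :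
    ‖∑ j, h j * z j‖ ^ p ≤
      (M * (n : ℝ) ^ (1 / min 2 p - 1 / p)) ^ p * ∑ j, ‖z j‖ ^ p := by
  have h1 : ‖∑ j, h j * z j‖ ^ 2 ≤ M ^ 2 * ∑ j, ‖z j‖ ^ 2 := by
    calc _ ≤ (∑ j, ‖h j‖ * ‖z j‖) ^ 2 := by
          gcongr
          exact (norm_sum_le _ _).trans (le_of_eq (by simp only [norm_mul]))
      _ ≤ (∑ j, ‖h j‖ ^ 2) * ∑ j, ‖z j‖ ^ 2 := Finset.sum_mul_sq_le_sq_mul_sq _ _ _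
      _ ≤ _ := by gcongr
  have e : ∀ x : ℝ, 0 ≤ x → (x ^ 2) ^ (p / 2) = x ^ p := fun x hx => by
    rw [← Real.rpow_natCast, ← Real.rpow_mul hx]
    congr 1; push_cast; ring
  have h2 := Real.rpow_le_rpow (by positivity) h1 (show 0 ≤ p / 2 by linarith)
  rw [e _ (norm_nonneg _), Real.mul_rpow (by positivity) (by positivity), e _ hM] at h2
  refine h2.trans ?_
  rw [Real.mul_rpow hM (by positivity), mul_assoc]
  gcongr
  exact sum_sq_rpow_le hp fun j => norm_nonneg _

/-- An operator of rank less than `n` annihilates a nontrivial combination of any `n` vectors. -/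
theorem exists_map_sum_smul_eq_zero {X : Type*} [AddCommGroup X] [Module ℂ X] {n : ℕ}
    {R : X →ₗ[ℂ] X} (hR : LinearMap.rank R < (n : Cardinal)) (v : Fin n → X) :
    ∃ a : Fin n → ℂ, R (∑ j, a j • v j) = 0 ∧ ∃ j, a j ≠ 0 := by
  have hli : ¬ LinearIndependent ℂ fun j => R.rangeRestrict (v j) := by
    intro h
    have := h.cardinal_lift_le_rank
    rw [Cardinal.mk_fin, Cardinal.lift_natCast, Cardinal.lift_uzero] at this
    exact absurd hR (not_lt.2 this)
  obtain ⟨a, ha, hj⟩ := Fintype.not_linearIndependent_iff.1 hli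
  refine ⟨a, ?_, hj⟩
  have := congrArg Subtype.val ha
  simpa [map_sum] using this

theorem dirichletEval_sum_smul {ι : Type*} (s : Finset ι) (a : ι → ℂ) (P : ι → ℕ+ →₀ ℂ) (w : ℂ) :
    dirichletEval (∑ i ∈ s, a i • P i) w = ∑ i ∈ s, a i * dirichletEval (P i) w := by
  classical
  induction s using Finset.induction_on with
  | empty => simp [dirichletEval]
  | insert i s hi ih =>
    rw [Finset.sum_insert hi, Finset.sum_insert hi, dirichletEval_add, dirichletEval_smul, ih]

theorem exists_normalized_map_sum_smul_eq_zero {X : Type*} [AddCommGroup X] [Module ℂ X] {n : ℕ}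
    {R : X →ₗ[ℂ] X} (hR : LinearMap.rank R < (n : Cardinal)) (v : Fin n → X) {p : ℝ} (hp : 0 < p) :
    ∃ a : Fin n → ℂ, R (∑ j, a j • v j) = 0 ∧ ∑ j, ‖a j‖ ^ p = 1 := by
  obtain ⟨a, ha, j, hj⟩ := exists_map_sum_smul_eq_zero hR v
  set A := ∑ j, ‖a j‖ ^ p
  have hA : 0 < A := Finset.sum_pos' (fun i _ => by positivity)
    ⟨j, Finset.mem_univ _, Real.rpow_pos_of_pos (norm_pos_iff.2 hj) _⟩
  refine ⟨fun j => ((A ^ (-(1 / p)) : ℝ) : ℂ) * a j, ?_, ?_⟩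
  · simp only [mul_smul, ← Finset.smul_sum, map_smul, ha, smul_zero]
  · have e : ∀ j, ‖((A ^ (-(1 / p)) : ℝ) : ℂ) * a j‖ ^ p = A⁻¹ * ‖a j‖ ^ p := fun j => by
      rw [norm_mul, Complex.norm_real, Real.norm_of_nonneg (by positivity),
        Real.mul_rpow (by positivity) (norm_nonneg _), ← Real.rpow_mul hA.le, neg_mul,
        one_div_mul_cancel hp.ne', Real.rpow_neg_one]
    simp only [e]
    rw [← Finset.mul_sum, inv_mul_cancel₀ hA.ne']

/-! ### The dual system and the norm of the test function -/

/-- The norm of a combination `∑ a_j h_j k_j` with `∑ |h_j|² ≤ M²` on the imaginary axis. -/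
theorem meanNorm_sum_mul_le {p : ℝ} (hp : 1 ≤ p) {n : ℕ} {F : ℕ+ →₀ ℂ} {H k : Fin n → ℕ+ →₀ ℂ}
    {a : Fin n → ℂ}
    (hF : ∀ w, dirichletEval F w = ∑ j, dirichletEval (H j) w * (a j * dirichletEval (k j) w))
    {M : ℝ} (hM : 0 ≤ M)
    (hH : ∀ t : ℝ, ∑ j, ‖dirichletEval (H j) (t * Complex.I)‖ ^ 2 ≤ M ^ 2)
    (hk : ∀ j, meanNorm p (k j) ≤ 1) (ha : ∑ j, ‖a j‖ ^ p = 1) :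
    meanNorm p F ≤ M * (n : ℝ) ^ (1 / min 2 p - 1 / p) := by
  have hp0 : 0 < p := by linarith
  set D := M * (n : ℝ) ^ (1 / min 2 p - 1 / p)
  have hD : 0 ≤ D := by positivity
  have hc : ∀ j, Continuous fun t : ℝ =>
      ‖a j‖ ^ p * ‖dirichletEval (k j) (t * Complex.I)‖ ^ p := fun j =>
    continuous_const.mul (continuous_norm_eval_rpow hp (k j))
  have hlim : Tendsto (fun T : ℝ => T⁻¹ * ∫ t in (0 : ℝ)..T,
      D ^ p * ∑ j, ‖a j‖ ^ p * ‖dirichletEval (k j) (t * Complex.I)‖ ^ p) atTop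
      (𝓝 (D ^ p * ∑ j, ‖a j‖ ^ p * meanNorm p (k j) ^ p)) := by
    refine ((tendsto_finsetSum Finset.univ fun j _ =>
      (tendsto_meanPow hp (k j)).const_mul (‖a j‖ ^ p)).const_mul (D ^ p)).congr fun T => ?_
    rw [intervalIntegral.integral_const_mul, intervalIntegral.integral_finsetSum
      (fun j _ => (hc j).intervalIntegrable _ _)]
    simp only [intervalIntegral.integral_const_mul, meanPow, Finset.mul_sum]
    refine Finset.sum_congr rfl fun j _ => ?_
    ring
  have h := meanNorm_rpow_le hp (P := F)
    (g := fun t => D ^ p * ∑ j, ‖a j‖ ^ p * ‖dirichletEval (k j) (t * Complex.I)‖ ^ p)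
    (continuous_const.mul (continuous_finsetSum _ fun j _ => hc j)) (fun t => ?_) hlim
  · have h1 : D ^ p * ∑ j, ‖a j‖ ^ p * meanNorm p (k j) ^ p ≤ D ^ p := by
      refine mul_le_of_le_one_right (by positivity) ?_
      rw [← ha]
      refine Finset.sum_le_sum fun j _ => mul_le_of_le_one_right (by positivity) ?_
      exact Real.rpow_le_one (meanNorm_nonneg hp _) (hk j) hp0.le
    exact (Real.rpow_le_rpow_iff (meanNorm_nonneg hp _) hD hp0).1 (h.trans h1)
  · rw [hF]
    refine (norm_sum_mul_rpow_le hp hM (hH t)).trans (le_of_eq ?_)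
    congr 1
    refine Finset.sum_congr rfl fun j _ => ?_
    rw [norm_mul, Real.mul_rpow (norm_nonneg _) (norm_nonneg _)]

/-- Interpolation in `ℋ^∞` yields Dirichlet polynomials that almost form a dual system to the
points, with a square function bound. -/
theorem exists_almost_dual_polynomials {n : ℕ} (hn : 1 ≤ n) {S : Fin n → ℂ}
    (hS : ∀ j, S j ∈ halfPlane 0) {K : ℝ}
    (hK : ∀ a : Fin n → ℂ, (∀ j, ‖a j‖ ≤ 1) → ∃ h : ℂ → ℂ, IsHInfty h ∧ (∀ j, h (S j) = a j) ∧
      ∀ s ∈ halfPlane 0, ‖h s‖ ≤ K) {ε : ℝ} (hε : 0 < ε) :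
    ∃ H : Fin n → ℕ+ →₀ ℂ,
      (∀ t : ℝ, ∑ j, ‖dirichletEval (H j) (t * Complex.I)‖ ^ 2 ≤ (K + ε) ^ 2) ∧
      ∀ j l, ‖dirichletEval (H j) (S l) - if j = l then 1 else 0‖ ≤ ε := by
  have hn0 : (0 : ℝ) < n := by exact_mod_cast hn
  have hnc : (n : ℂ) ≠ 0 := by exact_mod_cast hn0.ne'
  obtain ⟨U, hU1, hU⟩ := exists_orthogonal_unimodular hn
  -- Interpolating the rows, `h_k(s_l) = U_{kl}`, makes `n⁻¹ ∑_k conj(U_{kj}) h_k` equal to `δ_{jl}`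
  -- at `s_l`, by orthogonality of the columns. The unimodular data cost only the factor `K`.
  choose h hh hhS hhK using fun k => hK (U k) fun j => (hU1 k j).le
  choose Q hQ1 hQ2 using fun k => (hh k).exists_dirichletEval (hhK k) hS hε
  have hev : ∀ j w, dirichletEval ((n : ℂ)⁻¹ • ∑ k, star (U k j) • Q k) w =
      (n : ℂ)⁻¹ * ∑ k, star (U k j) * dirichletEval (Q k) w := fun j w => by
    rw [dirichletEval_smul, dirichletEval_sum_smul]
  refine ⟨fun j => (n : ℂ)⁻¹ • ∑ k, star (U k j) • Q k, fun t => ?_, fun j l => ?_⟩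
  · simp only [hev]
    exact sum_norm_sq_le_of_orthogonal hn hU fun k => hQ1 k t
  · rw [hev]
    have e : (if j = l then 1 else 0 : ℂ) = (n : ℂ)⁻¹ * ∑ k, star (U k j) * U k l := by
      rw [hU]; split_ifs <;> simp [hnc]
    rw [e, ← mul_sub, ← Finset.sum_sub_distrib, norm_mul, norm_inv, Complex.norm_natCast,
      inv_mul_le_iff₀ hn0]
    calc _ ≤ ∑ k : Fin n, ε := by
          refine norm_sum_le_of_le _ fun k _ => ?_
          rw [← mul_sub, norm_mul, norm_star, hU1, one_mul, ← hhS]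
          exact hQ2 k l
      _ = n * ε := by simp

/-! ### Distance to operators of small rank -/

section Main

variable {p : ℝ} [hp : Fact (1 ≤ p)]

theorem sum_smul_coe {ι : Type*} [Fintype ι] (a : ι → ℂ) (V : ι → DirichletPolynomial p) :
    ∑ j, a j • (V j : HardyDirichlet p) =
      ((∑ j, a j • V j : DirichletPolynomial p) : HardyDirichlet p) := by
  have h : UniformSpace.Completion.toComplₗᵢ (𝕜 := ℂ) (∑ j, a j • V j) =
    ∑ j, a j • UniformSpace.Completion.toComplₗᵢ (𝕜 := ℂ) (V j) := by simp only [map_sum, map_smul]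
  exact h.symm

/-- A lower bound for the distance from a composition operator to the operators of small rank. -/
theorem le_norm_sub_mul_of_rank_lt {φ : ℂ → ℂ} {T : HardyDirichlet p →L[ℂ] HardyDirichlet p}
    (hT : IsCompositionOperator φ T) {n : ℕ} (hn : 1 ≤ n) {S S' : Fin n → ℂ}
    (hS : ∀ j, S j ∈ halfPlane (1 / 2)) (hS' : ∀ j, S' j ∈ halfPlane (1 / 2))
    (hφ : ∀ j, φ (S' j) = S j) {R : HardyDirichlet p →L[ℂ] HardyDirichlet p}
    (hR : LinearMap.rank (R : HardyDirichlet p →ₗ[ℂ] HardyDirichlet p) < (n : Cardinal))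
    {K : ℝ} (hK0 : 0 ≤ K)
    (hK : ∀ a : Fin n → ℂ, (∀ j, ‖a j‖ ≤ 1) → ∃ h : ℂ → ℂ, IsHInfty h ∧ (∀ j, h (S j) = a j) ∧
      ∀ s ∈ halfPlane 0, ‖h s‖ ≤ K)
    {C : ℝ} (hC0 : 0 ≤ C) (hC : ∀ f : HardyDirichlet p,
      ∑ j, (realZeta (2 * (S' j).re))⁻¹ * ‖pointEval (S' j) f‖ ^ p ≤ C * ‖f‖ ^ p)
    {m : ℝ} (hm0 : 0 ≤ m)
    (hm : ∀ j, m ≤ (realZeta (2 * (S j).re) / realZeta (2 * (S' j).re)) ^ (1 / p)) :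
    m / 8 ≤ C ^ (1 / p) * (‖T - R‖ * (K * (n : ℝ) ^ (1 / min 2 p - 1 / p))) := by
  have hp1 := hp.out
  have hp0 : 0 < p := by linarith
  have hSr : ∀ j, 1 / 2 < (S j).re := hS
  have hSr' : ∀ j, 1 / 2 < (S' j).re := hS'
  have hζ : ∀ j, 1 ≤ realZeta (2 * (S j).re) := fun j => one_le_realZeta (by linarith [hSr j])
  have hζ' : ∀ j, 1 ≤ realZeta (2 * (S' j).re) := fun j => one_le_realZeta (by linarith [hSr' j])
  choose k hk1 hk2 using fun j => exists_large_dirichletEval hp1 (hSr j)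
  -- `b l` controls the error at `s_l` due to inexact duality. The `k_j` are fixed before `ε`, so
  -- `b` and `B` do not depend on `ε`, and the error term `ε * B` vanishes in the limit.
  set b : Fin n → ℝ := fun l => ∑ j, ‖dirichletEval (k j) (S l)‖
  have hb0 : ∀ l, 0 ≤ b l := fun l => Finset.sum_nonneg fun j _ => norm_nonneg _
  set B := (∑ l, b l ^ p) ^ (1 / p)
  set τ := (n : ℝ) ^ (1 / min 2 p - 1 / p)
  have hτ : 0 ≤ τ := by positivity
  have main : ∀ ε > 0, m / 8 ≤ C ^ (1 / p) * (‖T - R‖ * ((K + ε) * τ)) + ε * B := by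
    intro ε hε
    obtain ⟨H, hH1, hH2⟩ := exists_almost_dual_polynomials hn
      (fun j => show (0 : ℝ) < (S j).re by linarith [hSr j]) hK hε
    choose W hW using fun j => exists_dirichletEval_mul (H j) (k j)
    let V : Fin n → DirichletPolynomial p := W
    -- The coefficients make `f = ∑ a_j h_j k_j` lie in the kernel of `R`.
    obtain ⟨a, haR, ha⟩ := exists_normalized_map_sum_smul_eq_zero hR
      (fun j => (V j : HardyDirichlet p)) hp0
    set F : DirichletPolynomial p := ∑ j, a j • V j with hFdef
    set f : HardyDirichlet p := (F : HardyDirichlet p) with hf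
    rw [sum_smul_coe, ← hFdef, ← hf] at haR
    have hFe : ∀ w, dirichletEval F w =
        ∑ j, dirichletEval (H j) w * (a j * dirichletEval (k j) w) := fun w =>
      (dirichletEval_sum_smul Finset.univ a W w).trans
        (Finset.sum_congr rfl fun j _ => by rw [hW]; ring)
    have hFn : ‖f‖ ≤ (K + ε) * τ := by
      rw [hf, UniformSpace.Completion.norm_coe]
      exact meanNorm_sum_mul_le hp1 hFe (by positivity) hH1 hk1 ha
    have hTf : ‖T f‖ ≤ ‖T - R‖ * ((K + ε) * τ) := by
      have e : T f = (T - R) f := by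
        have : R f = 0 := haR
        simp [this]
      rw [e]
      exact ((T - R).le_opNorm f).trans (by gcongr)
    have hval : ∀ l, pointEval (S' l) (T f) = dirichletEval F (S l) := fun l => by
      rw [hT f _ (hS' l), hφ]
      exact pointEval_coe (hS l) _
    have hcarl := hC (T f)
    simp only [hval] at hcarl
    have ha1 : ∀ j, ‖a j‖ ≤ 1 := fun j => by
      have : ‖a j‖ ^ p ≤ 1 ^ p := by
        rw [Real.one_rpow, ← ha]
        exact Finset.single_le_sum (f := fun j => ‖a j‖ ^ p) (fun i _ => by positivity)
          (Finset.mem_univ j)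
      exact (Real.rpow_le_rpow_iff (norm_nonneg _) zero_le_one hp0).1 this
    -- With exact duality `F(s_l)` would equal `a_l k_l(s_l)`; each off-diagonal or diagonal defect
    -- is at most `ε`, and `|a_j| ≤ 1`.
    have herr : ∀ l, ‖a l * dirichletEval (k l) (S l) - dirichletEval F (S l)‖ ≤ ε * b l := by
      intro l
      have e : a l * dirichletEval (k l) (S l) =
          ∑ j, (if j = l then 1 else 0) * (a j * dirichletEval (k j) (S l)) := by simp
      rw [e, hFe, ← Finset.sum_sub_distrib, Finset.mul_sum]
      refine norm_sum_le_of_le _ fun j _ => ?_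
      rw [← sub_mul, norm_mul, norm_sub_rev, norm_mul]
      gcongr
      · exact hH2 j l
      · exact mul_le_of_le_one_left (norm_nonneg _) (ha1 j)
    set z : Fin n → ℝ := fun l => (realZeta (2 * (S' l).re))⁻¹ ^ (1 / p) with hz
    have hz0 : ∀ l, 0 ≤ z l := fun l => by have := hζ' l; positivity
    have hz1 : ∀ l, z l ≤ 1 := fun l => Real.rpow_le_one (by have := hζ' l; positivity)
      (inv_le_one_of_one_le₀ (hζ' l)) (by positivity)
    have hlow : ∀ l, m / 8 * ‖a l‖ ≤ z l * ‖dirichletEval F (S l)‖ + ε * b l := by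
      intro l
      have h1 : m / 8 ≤ z l * ‖dirichletEval (k l) (S l)‖ := by
        have e : (realZeta (2 * (S l).re) / realZeta (2 * (S' l).re)) ^ (1 / p) =
            z l * realZeta (2 * (S l).re) ^ (1 / p) := by
          rw [hz, ← Real.mul_rpow (by have := hζ' l; positivity) (by linarith [hζ l]),
            div_eq_inv_mul]
        have h2 := hm l
        rw [e] at h2
        have h3 := mul_le_mul_of_nonneg_left (hk2 l) (hz0 l)
        linarith
      have h2 : ‖a l * dirichletEval (k l) (S l)‖ ≤ ‖dirichletEval F (S l)‖ + ε * b l := by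
        have := norm_sub_norm_le (a l * dirichletEval (k l) (S l)) (dirichletEval F (S l))
        linarith [herr l]
      calc m / 8 * ‖a l‖ ≤ z l * ‖dirichletEval (k l) (S l)‖ * ‖a l‖ := by gcongr
        _ = z l * ‖a l * dirichletEval (k l) (S l)‖ := by rw [norm_mul]; ring
        _ ≤ z l * (‖dirichletEval F (S l)‖ + ε * b l) :=
          mul_le_mul_of_nonneg_left h2 (hz0 l)
        _ = z l * ‖dirichletEval F (S l)‖ + z l * (ε * b l) := by ring
        _ ≤ _ := by
          have := mul_le_of_le_one_left (mul_nonneg hε.le (hb0 l)) (hz1 l)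
          linarith
    have hzp : ∀ l, (z l * ‖dirichletEval F (S l)‖) ^ p =
        (realZeta (2 * (S' l).re))⁻¹ * ‖dirichletEval F (S l)‖ ^ p := fun l => by
      have := hζ' l
      rw [Real.mul_rpow (hz0 l) (norm_nonneg _), hz, ← Real.rpow_mul (by positivity),
        one_div_mul_cancel hp0.ne', Real.rpow_one]
    -- Minkowski's inequality splits the weighted values of `F`, handled by the Carleson inequality,
    -- from the duality error.
    have hmink := Real.Lp_add_le Finset.univ (fun l => z l * ‖dirichletEval F (S l)‖)
      (fun l => ε * b l) hp1
    have hleft : m / 8 ≤ (∑ l, |z l * ‖dirichletEval F (S l)‖ + ε * b l| ^ p) ^ (1 / p) := by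
      have e : (∑ l, (m / 8 * ‖a l‖) ^ p) ^ (1 / p) = m / 8 := by
        simp only [Real.mul_rpow (show 0 ≤ m / 8 by positivity) (norm_nonneg _)]
        rw [← Finset.mul_sum, ha, mul_one, ← Real.rpow_mul (by positivity),
          mul_one_div_cancel hp0.ne', Real.rpow_one]
      rw [← e]
      gcongr with l
      exact (hlow l).trans (le_abs_self _)
    have hr1 : (∑ l, |z l * ‖dirichletEval F (S l)‖| ^ p) ^ (1 / p) ≤
        C ^ (1 / p) * (‖T - R‖ * ((K + ε) * τ)) := by
      simp only [abs_of_nonneg (mul_nonneg (hz0 _) (norm_nonneg _)), hzp]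
      calc _ ≤ (C * ‖T f‖ ^ p) ^ (1 / p) := by
            refine Real.rpow_le_rpow (Finset.sum_nonneg fun l _ => ?_) hcarl (by positivity)
            have := hζ' l
            positivity
        _ = C ^ (1 / p) * ‖T f‖ := by
            rw [Real.mul_rpow hC0 (by positivity), ← Real.rpow_mul (norm_nonneg _),
              mul_one_div_cancel hp0.ne', Real.rpow_one]
        _ ≤ _ := by gcongr
    have hr2 : (∑ l, |ε * b l| ^ p) ^ (1 / p) = ε * B := by
      simp only [abs_of_nonneg (mul_nonneg hε.le (hb0 _)), Real.mul_rpow hε.le (hb0 _)]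
      rw [← Finset.mul_sum, Real.mul_rpow (by positivity)
        (Finset.sum_nonneg fun l _ => by have := hb0 l; positivity), ← Real.rpow_mul hε.le,
        mul_one_div_cancel hp0.ne', Real.rpow_one]
    linarith
  have hlim : Tendsto (fun ε : ℝ => C ^ (1 / p) * (‖T - R‖ * ((K + ε) * τ)) + ε * B) (𝓝[>] 0)
      (𝓝 (C ^ (1 / p) * (‖T - R‖ * ((K + 0) * τ)) + 0 * B)) :=
    (Continuous.tendsto (by fun_prop) _).mono_left nhdsWithin_le_nhds
  rw [zero_mul, add_zero, add_zero] at hlim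
  exact ge_of_tendsto hlim (eventually_mem_nhdsWithin.mono fun ε hε => main ε hε)

end Main

/-! ### Unattained infima and extended real values -/

theorem exists_interpolating_of_interpolationConstant_lt {n : ℕ} {S : Fin n → ℂ} {K : ℝ}
    (hK0 : 0 ≤ K) (hK : interpolationConstant S < ENNReal.ofReal K) (a : Fin n → ℂ)
    (ha : ∀ j, ‖a j‖ ≤ 1) :
    ∃ h : ℂ → ℂ, IsHInfty h ∧ (∀ j, h (S j) = a j) ∧ ∀ s ∈ halfPlane 0, ‖h s‖ ≤ K := by
  obtain ⟨K₀, hK₀, hlt⟩ := sInf_lt_iff.1 hK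
  obtain ⟨h, hh, hS, hb⟩ := hK₀ a (Set.finite_range _).bddAbove
  refine ⟨h, hh, hS, fun s hs => ?_⟩
  have h1 : ‖h s‖ₑ ≤ K₀ * ⨆ j, ‖a j‖ₑ :=
    (le_iSup₂ (f := fun s (_ : s ∈ halfPlane 0) => ‖h s‖ₑ) s hs).trans hb
  have h2 : ⨆ j, ‖a j‖ₑ ≤ 1 := iSup_le fun j => by
    rw [← ofReal_norm]
    exact ENNReal.ofReal_le_one.2 (ha j)
  have h3 : ‖h s‖ₑ ≤ ENNReal.ofReal K :=
    calc _ ≤ K₀ * ⨆ j, ‖a j‖ₑ := h1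
      _ ≤ K₀ * 1 := by gcongr
      _ ≤ _ := by rw [mul_one]; exact hlt.le
  rw [← ofReal_norm] at h3
  exact (ENNReal.ofReal_le_ofReal_iff hK0).1 h3

theorem lintegral_le_of_carlesonNorm_lt {p : ℝ} [Fact (1 ≤ p)] {μ : Measure ℂ} {C : ℝ≥0∞}
    (hC : carlesonNorm p μ < C) (f : HardyDirichlet p) :
    ∫⁻ s in halfPlane (1 / 2), ‖pointEval s f‖ₑ ^ p ∂μ ≤ C * ‖f‖ₑ ^ p := by
  obtain ⟨C₀, hC₀, hlt⟩ := sInf_lt_iff.1 hC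
  exact (hC₀ f).trans (by gcongr)

/-- Since `n ≥ 1`, the zero operator is admissible: the infimum is over a nonempty set, and `x` is
finite, so the comparison can be made in `ℝ`. -/
theorem le_ofReal_approximationNumber {X : Type*} [NormedAddCommGroup X] [NormedSpace ℂ X] {n : ℕ}
    (hn : 1 ≤ n) {T : X →L[ℂ] X} {x : ℝ≥0∞}
    (hx : ∀ R : X →L[ℂ] X, LinearMap.rank (R : X →ₗ[ℂ] X) < (n : Cardinal) →
      x ≤ ENNReal.ofReal ‖T - R‖) : x ≤ ENNReal.ofReal (approximationNumber n T) := by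
  have h0 : LinearMap.rank ((0 : X →L[ℂ] X) : X →ₗ[ℂ] X) < (n : Cardinal) := by
    rw [ContinuousLinearMap.toLinearMap_zero, LinearMap.rank_zero]
    exact_mod_cast hn
  have hfin : x ≠ ∞ := ((hx 0 h0).trans_lt ENNReal.ofReal_lt_top).ne
  rw [← ENNReal.ofReal_toReal hfin]
  refine ENNReal.ofReal_le_ofReal (le_csInf ⟨_, 0, h0, rfl⟩ ?_)
  rintro _ ⟨R, hR, rfl⟩
  exact ENNReal.toReal_le_of_le_ofReal (norm_nonneg _) (hx R hR)

end DirichletHardy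

theorem theorem6p1 (p : ℝ) [Fact (1 ≤ p)] :
    ∃ ρ : ℝ, 0 < ρ ∧
      ∀ (c₀ : ℕ) (c : ℕ+ → ℂ) (φ : ℂ → ℂ), IsSymbol c₀ c φ →
      ∀ T : HardyDirichlet p →L[ℂ] HardyDirichlet p,
        IsCompositionOperator φ T → IsCompactOperator T →
      ∀ (n : ℕ), 1 ≤ n → ∀ S S' : Fin n → ℂ,
        Function.Injective S → Function.Injective S' →
        (∀ j, S j ∈ halfPlane (1 / 2)) → (∀ j, S' j ∈ halfPlane (1 / 2)) →
        (∀ j, φ (S' j) = S j) →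
        ENNReal.ofReal (ρ * (n : ℝ) ^ (-(1 / min 2 p - 1 / p))) *
            (interpolationConstant S)⁻¹ *
            carlesonNorm p (pointMeasure p S') ^ (-(1 / p)) *
            ⨅ j, ENNReal.ofReal
              ((realZeta (2 * (S j).re) / realZeta (2 * (S' j).re)) ^ (1 / p)) ≤
          ENNReal.ofReal (approximationNumber n T) := by
  refine ⟨1 / 8, by norm_num, ?_⟩
  intro c₀ c φ _ T hT _ n hn S S' _ _ hS hS' hφ
  refine le_ofReal_approximationNumber hn fun R hR => ?_
  have hp1 : 1 ≤ p := Fact.out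
  have hp0 : 0 < p := by linarith
  have hn0 : (0 : ℝ) < n := by exact_mod_cast hn
  set I := ⨅ j, ENNReal.ofReal
    ((realZeta (2 * (S j).re) / realZeta (2 * (S' j).re)) ^ (1 / p)) with hI
  have hItop : I ≠ ∞ := by
    rw [hI]
    exact ne_top_of_le_ne_top ENNReal.ofReal_ne_top (iInf_le _ (⟨0, hn⟩ : Fin n))
  -- An infinite interpolation or Carleson constant enters with a negative power and makes the left
  -- side `0`.
  rcases eq_or_ne (interpolationConstant S) ∞ with hKtop | hKtop
  · simp [hKtop]
  rcases eq_or_ne (carlesonNorm p (pointMeasure p S')) ∞ with hCtop | hCtop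
  · rw [hCtop, ENNReal.top_rpow_of_neg (by simpa using hp0)]
    simp
  set K := (interpolationConstant S).toReal with hK
  set C := (carlesonNorm p (pointMeasure p S')).toReal with hC
  have hKe : interpolationConstant S = ENNReal.ofReal K := (ENNReal.ofReal_toReal hKtop).symm
  have hCe : carlesonNorm p (pointMeasure p S') = ENNReal.ofReal C :=
    (ENNReal.ofReal_toReal hCtop).symm
  have hIe : I = ENNReal.ofReal I.toReal := (ENNReal.ofReal_toReal hItop).symm
  have hK0 : 0 ≤ K := ENNReal.toReal_nonneg
  have hC0 : 0 ≤ C := ENNReal.toReal_nonneg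
  set τ := 1 / min 2 p - 1 / p with hτ
  -- The constants are infima that need not be attained, so the estimate is applied with `K + ε` and
  -- `C + ε` and `ε` tends to `0`.
  have key : ∀ ε > 0,
      I.toReal / 8 ≤ (C + ε) ^ (1 / p) * (‖T - R‖ * ((K + ε) * (n : ℝ) ^ τ)) := by
    intro ε hε
    refine le_norm_sub_mul_of_rank_lt hT hn hS hS' hφ hR (by positivity)
      (exists_interpolating_of_interpolationConstant_lt (by positivity) ?_) (by positivity)
      (sum_pointEval_le_of_carleson hS' (by positivity) (lintegral_le_of_carlesonNorm_lt ?_))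
      ENNReal.toReal_nonneg fun j => ?_
    · rw [hKe]
      exact (ENNReal.ofReal_lt_ofReal_iff (by positivity)).2 (by linarith)
    · rw [hCe]
      exact (ENNReal.ofReal_lt_ofReal_iff (by positivity)).2 (by linarith)
    · refine ENNReal.toReal_le_of_le_ofReal ?_ (iInf_le _ j)
      have h1 : 1 / 2 < (S j).re := hS j
      have h2 : 1 / 2 < (S' j).re := hS' j
      have h3 := one_le_realZeta (x := 2 * (S j).re) (by linarith)
      have h4 := one_le_realZeta (x := 2 * (S' j).re) (by linarith)
      positivity
  have hlim : Tendsto (fun ε : ℝ =>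
      (C + ε) ^ (1 / p) * (‖T - R‖ * ((K + ε) * (n : ℝ) ^ τ))) (𝓝[>] 0)
      (𝓝 ((C + 0) ^ (1 / p) * (‖T - R‖ * ((K + 0) * (n : ℝ) ^ τ)))) := by
    refine (Continuous.tendsto (Continuous.mul ?_ (by fun_prop)) _).mono_left nhdsWithin_le_nhds
    exact Continuous.rpow_const (by fun_prop) fun _ => Or.inr (by positivity)
  rw [add_zero, add_zero] at hlim
  have hfin := ge_of_tendsto hlim (eventually_mem_nhdsWithin.mono fun ε hε => key ε hε)
  -- A vanishing constant would enter the left side as `∞`. The limiting estimate then forces `I =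
  -- 0`, and `∞ * 0 = 0`, so positivity of the constants need not be proved.
  have hI0 : (K = 0 ∨ C = 0) → I = 0 := by
    intro h
    have : I.toReal ≤ 0 := by
      rcases h with h | h
      · rw [h] at hfin
        simp at hfin
        linarith
      · rw [h, Real.zero_rpow (by positivity)] at hfin
        simp at hfin
        linarith
    rw [hIe, ENNReal.ofReal_eq_zero.2 this]
  by_cases hz : K = 0 ∨ C = 0
  · rw [hI0 hz, mul_zero]
    exact zero_le
  push Not at hz
  have hK' : 0 < K := lt_of_le_of_ne hK0 hz.1.symm
  have hC' : 0 < C := lt_of_le_of_ne hC0 hz.2.symm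
  rw [hKe, hCe, hIe, ← ENNReal.ofReal_inv_of_pos hK', ENNReal.ofReal_rpow_of_pos hC',
    ← ENNReal.ofReal_mul (by positivity), ← ENNReal.ofReal_mul (by positivity),
    ← ENNReal.ofReal_mul (by positivity)]
  refine ENNReal.ofReal_le_ofReal ?_
  rw [Real.rpow_neg hn0.le, Real.rpow_neg hC0]
  have h1 : 0 < (n : ℝ) ^ τ := by positivity
  have h2 : 0 < C ^ (1 / p) := by positivity
  calc _ = (I.toReal / 8) * (((n : ℝ) ^ τ)⁻¹ * K⁻¹ * (C ^ (1 / p))⁻¹) := by ring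
    _ ≤ (C ^ (1 / p) * (‖T - R‖ * (K * (n : ℝ) ^ τ))) *
        (((n : ℝ) ^ τ)⁻¹ * K⁻¹ * (C ^ (1 / p))⁻¹) := by gcongr
    _ = ‖T - R‖ := by field_simp
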